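/- Let $X$ be a set and let $T\subset X\times X$ contain the diagonal $\phi(0)=\{(x,x):x\in X\}$. For $A,B\subset X\times X$ write $A^{-1}=\{(x,y):(y,x)\in A\}$ and $A\circ B=\{(x,y):\exists z,\ (x,z)\in A,\ (z,y)\in B\}$. Let $\mathcal C$ be the coarse structure on $X$ generated by $T$, i.e. $F\in\mathcal C$ if and only if $F\subset(T^{-1}\cup T)^{\circ n}$ for some $n$, and suppose that $(X,\mathcal C)$ is uniformly locally finite, i.e. $\sup_{x\in X}\#\{y:(y,x)\in F\}<\infty$ for all $F\in\mathcal C$. Let $X^{(2)}=\bigcup\mathcal C$; it is an equivalence relation on $X$, regarded as a groupoid with range map $(x,y)\mapsto x$, source map $(x,y)\mapsto y$ (where $x\in X$ is identified with the unit $(x,x)$), product $(x,y)(y,z)=(x,z)$ and inverse $(x,y)^{-1}=(y,x)$. Let $\phi(0),\phi(1),\dots,\phi(k)$ be a label on $T$: $T=\bigcup_{j=0}^k\phi(j)$, with $\phi(0)$ the diagonal, and each $\phi(j)$ is the graph of a bijection between two subsets of $X$. Let $h\colon X^{(2)}\to[0,\infty]$ be an arbitrary function. Then there exist a locally compact Hausdorff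 second countable étale groupoid $\Gamma$, with space of units $\Gamma(0)\subset\Gamma$, range map $t$ and source map $s$; a groupoid homomorphism $\Theta\colon X^{(2)}\to\Gamma$; a continuous function $H\colon\Gamma\to[0,\infty]$; and compact open subsets $\Gamma(1),\dots,\Gamma(k)\subset\Gamma$, such that (a) $\Gamma(0)$ is compact; (b) $H(\Theta(x,y))=h(x,y)$ for all $(x,y)\in X^{(2)}$; (c) the groupoid $\Gamma$ is generated by $\Gamma(0),\Gamma(1),\dots,\Gamma(k)$; (d) for $j=0,1,\dots,k$, the maps $t$ and $s$ are injective on $\Gamma(j)$; (e) for $j=0,1,\dots,k$, the closure of $\Theta(\phi(j))$ is $\Gamma(j)$, and $\Theta^{-1}(\Gamma(j))=\phi(j)$; (f) for all $\gamma\in\Gamma$ and $x,y\in X$: if $t(\gamma)=\Theta(x,x)$, then there is $z\in X$ with $(x,z)\in X^{(2)}$ and $\gamma=\Theta(x,z)$; if $s(\gamma)=\Theta(y,y)$, then there is $z\in X$ with $(z,y)\in X^{(2)}$ and $\gamma=\Theta(z,y)$. Moreover, $\Gamma$ can be taken to be the Gelfand spectrum of a separable commutative C*-algebra: there are a separable C*-subalgebra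 $C\subset\ell^\infty(X^{(2)})$ and a homeomorphism from $\Gamma$ onto the character space of $C$ under which $\Theta(x,y)$ corresponds to the character $f\mapsto f(x,y)$. -/

import Mathlib

open scoped ENNReal

universe u v

/-- A coarse structure on a set `X`: a family of subsets of `X × X` (the controlled sets) which
contains the diagonal and is closed under subsets, (finite) unions, inverses and products. -/
structure CoarseStructure (X : Type u) where
  controlled : Set (SetRel X X)
  id_mem : SetRel.id ∈ controlled
  subset_mem : ∀ {E F : SetRel X X}, E ⊆ F → F ∈ controlled → E ∈ controlled
  union_mem : ∀ {E F : SetRel X X}, E ∈ controlled → F ∈ controlled → E ∪ F ∈ controlled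
  inv_mem : ∀ {E : SetRel X X}, E ∈ controlled → SetRel.inv E ∈ controlled
  comp_mem : ∀ {E F : SetRel X X}, E ∈ controlled → F ∈ controlled → SetRel.comp E F ∈ controlled

/-- The `n`-fold product `T ∘ T ∘ ⋯ ∘ T`; the power `0` is the diagonal. -/
def SetRel.npow {X : Type u} (T : SetRel X X) : ℕ → SetRel X X
  | 0 => SetRel.id
  | n + 1 => SetRel.comp (SetRel.npow T n) T

namespace CoarseStructure

variable {X : Type u} (𝒞 : CoarseStructure X)

/-- Every controlled set `F` satisfies `sup_x #F[x] < ∞`, where `F[x] = {y ; (y, x) ∈ F}`. -/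
def UniformlyLocallyFinite : Prop :=
  ∀ F ∈ 𝒞.controlled, ∃ N : ℕ, ∀ x : X, {y : X | (y, x) ∈ F}.encard ≤ N

/-- The controlled sets are exactly the subsets of the powers of `T⁻¹ ∪ T`. -/
def IsGeneratedBy (T : SetRel X X) : Prop :=
  ∀ F : SetRel X X, F ∈ 𝒞.controlled ↔ ∃ n : ℕ, F ⊆ SetRel.npow (SetRel.inv T ∪ T) n

/-- The equivalence relation `X⁽²⁾ = ⋃ 𝒞` of connected pairs. -/
def connected : SetRel X X := ⋃₀ 𝒞.controlled

lemma connected_refl (x : X) : (x, x) ∈ 𝒞.connected :=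
  ⟨SetRel.id, 𝒞.id_mem, rfl⟩

lemma connected_symm {x y : X} (h : (x, y) ∈ 𝒞.connected) : (y, x) ∈ 𝒞.connected := by
  obtain ⟨E, hE, hxy⟩ := h
  exact ⟨SetRel.inv E, 𝒞.inv_mem hE, hxy⟩

lemma connected_trans {x y z : X} (h : (x, y) ∈ 𝒞.connected) (h' : (y, z) ∈ 𝒞.connected) :
    (x, z) ∈ 𝒞.connected := by
  obtain ⟨E, hE, hxy⟩ := h
  obtain ⟨F, hF, hyz⟩ := h'
  exact ⟨SetRel.comp E F, 𝒞.comp_mem hE hF, ⟨y, hxy, hyz⟩⟩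

end CoarseStructure

/-- A label on `T`: subsets `φ 0, …, φ k` with union `T`, where `φ 0` is the diagonal and every
`φ j` is the graph of a bijection between subsets of `X`. -/
structure IsLabel {X : Type u} (T : SetRel X X) {k : ℕ} (φ : Fin (k + 1) → SetRel X X) : Prop where
  zero : φ 0 = SetRel.id
  iUnion : T = ⋃ j, φ j
  right_unique : ∀ j z x y, (z, x) ∈ φ j → (z, y) ∈ φ j → x = y
  left_unique : ∀ j z x y, (x, z) ∈ φ j → (y, z) ∈ φ j → x = y

/-- A groupoid structure on a set `Γ` (the set of arrows): the units form a subset of `Γ`, `t` is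
the range map, `s` the source map, and `mul` is defined on the composable pairs. -/
structure GroupoidStr (Γ : Type u) where
  units : Set Γ
  t : Γ → Γ
  s : Γ → Γ
  mul : {q : Γ × Γ // s q.1 = t q.2} → Γ
  inv : Γ → Γ
  t_mem : ∀ a, t a ∈ units
  s_mem : ∀ a, s a ∈ units
  t_unit : ∀ a ∈ units, t a = a
  s_unit : ∀ a ∈ units, s a = a
  t_mul : ∀ q, t (mul q) = t q.1.1
  s_mul : ∀ q, s (mul q) = s q.1.2
  t_inv : ∀ a, t (inv a) = s a
  s_inv : ∀ a, s (inv a) = t a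
  unit_mul : ∀ a, mul ⟨(t a, a), s_unit _ (t_mem a)⟩ = a
  mul_unit : ∀ a, mul ⟨(a, s a), (t_unit _ (s_mem a)).symm⟩ = a
  mul_assoc : ∀ (a b c : Γ) (hab : s a = t b) (hbc : s b = t c),
    mul ⟨(mul ⟨(a, b), hab⟩, c), (s_mul ⟨(a, b), hab⟩).trans hbc⟩ =
      mul ⟨(a, mul ⟨(b, c), hbc⟩), hab.trans (t_mul ⟨(b, c), hbc⟩).symm⟩
  mul_inv : ∀ a, mul ⟨(a, inv a), (t_inv a).symm⟩ = t a
  inv_mul : ∀ a, mul ⟨(inv a, a), s_inv a⟩ = s a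

namespace GroupoidStr

/-- A homomorphism of groupoids: it intertwines the range and source maps (hence sends composable
pairs to composable pairs) and it is multiplicative. -/
structure IsHom {Λ : Type u} {Γ : Type v} (ℒ : GroupoidStr Λ) (𝒢 : GroupoidStr Γ)
    (f : Λ → Γ) : Prop where
  map_t : ∀ a, f (ℒ.t a) = 𝒢.t (f a)
  map_s : ∀ a, f (ℒ.s a) = 𝒢.s (f a)
  map_mul : ∀ (a b : Λ) (h : ℒ.s a = ℒ.t b) (h' : 𝒢.s (f a) = 𝒢.t (f b)),
    f (ℒ.mul ⟨(a, b), h⟩) = 𝒢.mul ⟨(f a, f b), h'⟩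

variable {Γ : Type u} (𝒢 : GroupoidStr Γ)

/-- A subset closed under products and inverses. -/
structure IsSubgroupoid (S : Set Γ) : Prop where
  mul_mem : ∀ q : {q : Γ × Γ // 𝒢.s q.1 = 𝒢.t q.2}, q.1.1 ∈ S → q.1.2 ∈ S → 𝒢.mul q ∈ S
  inv_mem : ∀ a ∈ S, 𝒢.inv a ∈ S

/-- The smallest subgroupoid containing `A` is the whole groupoid. -/
def IsGeneratedBy (A : Set Γ) : Prop :=
  ∀ S : Set Γ, 𝒢.IsSubgroupoid S → A ⊆ S → S = Set.univ

/-- An étale (topological) groupoid: product and inverse are continuous, and the range and source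
maps are local homeomorphisms onto open subsets of the space of units (with the subspace
topology); in particular they are continuous. -/
structure IsEtale [TopologicalSpace Γ] : Prop where
  continuous_mul : Continuous 𝒢.mul
  continuous_inv : Continuous 𝒢.inv
  t_local : IsLocalHomeomorph (fun a => (⟨𝒢.t a, 𝒢.t_mem a⟩ : 𝒢.units))
  s_local : IsLocalHomeomorph (fun a => (⟨𝒢.s a, 𝒢.s_mem a⟩ : 𝒢.units))

end GroupoidStr

/-- The groupoid structure of the equivalence relation `X⁽²⁾`: range `(x, y) ↦ x`, source
`(x, y) ↦ y` (units being the diagonal pairs), `(x, y)(y, z) = (x, z)`, `(x, y)⁻¹ = (y, x)`. -/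
def CoarseStructure.pairGroupoid {X : Type u} (𝒞 : CoarseStructure X) :
    GroupoidStr 𝒞.connected where
  units := {p | p.1.1 = p.1.2}
  t p := ⟨(p.1.1, p.1.1), 𝒞.connected_refl _⟩
  s p := ⟨(p.1.2, p.1.2), 𝒞.connected_refl _⟩
  mul q := ⟨(q.1.1.1.1, q.1.2.1.2), 𝒞.connected_trans q.1.1.2 (by
    have h : q.1.1.1.2 = q.1.2.1.1 := congrArg (fun p => p.1.1) q.2
    rw [h]
    exact q.1.2.2)⟩
  inv p := ⟨(p.1.2, p.1.1), 𝒞.connected_symm p.2⟩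
  t_mem _ := rfl
  s_mem _ := rfl
  t_unit := by
    rintro ⟨⟨x, y⟩, h⟩ (rfl : x = y)
    rfl
  s_unit := by
    rintro ⟨⟨x, y⟩, h⟩ (rfl : x = y)
    rfl
  t_mul _ := rfl
  s_mul _ := rfl
  t_inv _ := rfl
  s_inv _ := rfl
  unit_mul _ := rfl
  mul_unit _ := rfl
  mul_assoc _ _ _ _ _ := rfl
  mul_inv _ := rfl
  inv_mul _ := rfl

/-! The groupoid is a Stone space. Starting from `T`, the `φ j` and the superlevel sets of `h` at a
countable dense set of values, countably many operations generate a countable ring of controlled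
relations, closed under unions, differences, inverses and products. Its prime filters are the
arrows, and the sets of arrows containing a given relation are compact, open and form a countable
basis. A pair in X⁽²⁾ gives the filter of the relations containing it; this is `Θ`.

Range, product and inverse of filters are induced by the same operations on relations. The label
makes everything étale: each relation is covered by finitely many bisections, so by primality every
arrow contains a bisection, and an arrow is determined by a bisection it contains together with its
range (`eq_of_t_eq`). Conversely, a unit containing the domain of a relation lifts to an arrow
containing that relation (`exists_lift`). Hence the range map is open and locally injective, an
arrow whose range is a point of `X` comes from a pair, and an arrow containing A ∘ B factors through
A and B, which gives generation.

`H` exists because the ring can cut its members along superlevel sets of `h`. The spectrum statement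
is Stone–Gelfand duality: an arrow acts by limits on the closed span of the indicator functions, and
a character, being 0 or 1 on each indicator, selects a prime filter. -/

open scoped SetRel Topology

/-! ### Domains and bisections -/

namespace SetRel

variable {X : Type u}

/-- The set of units `(x, x)` such that `x` belongs to the domain of `A`. -/
def unitDom (A : SetRel X X) : SetRel X X := {p | p.1 = p.2 ∧ ∃ y, (p.1, y) ∈ A}

lemma unitDom_mono {A B : SetRel X X} (h : A ⊆ B) : A.unitDom ⊆ B.unitDom :=
  fun _ hp => ⟨hp.1, hp.2.imp fun _ hy => h hy⟩

lemma unitDom_eq (A : SetRel X X) : A.unitDom = (A ○ A.inv) ∩ SetRel.id := by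
  ext ⟨x, y⟩
  constructor
  · rintro ⟨rfl : x = y, z, hz⟩
    exact ⟨⟨z, hz, hz⟩, rfl⟩
  · rintro ⟨⟨z, hz, -⟩, h⟩
    exact ⟨h, z, hz⟩

/-- Every point of the domain is related to a single point. -/
def RightUnique (A : SetRel X X) : Prop := ∀ z x y, (z, x) ∈ A → (z, y) ∈ A → x = y

/-- A relation that is the graph of a bijection between two subsets. -/
def IsBisection (A : SetRel X X) : Prop := A.RightUnique ∧ A.inv.RightUnique

lemma RightUnique.mono {A B : SetRel X X} (h : A ⊆ B) (hB : B.RightUnique) : A.RightUnique :=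
  fun z x y hx hy => hB z x y (h hx) (h hy)

lemma IsBisection.mono {A B : SetRel X X} (h : A ⊆ B) (hB : B.IsBisection) : A.IsBisection :=
  ⟨hB.1.mono h, hB.2.mono (inv_mono h)⟩

lemma IsBisection.inv {A : SetRel X X} (hA : A.IsBisection) : A.inv.IsBisection := ⟨hA.2, hA.1⟩

lemma RightUnique.comp {A B : SetRel X X} (hA : A.RightUnique) (hB : B.RightUnique) :
    (A ○ B).RightUnique := by
  rintro z x y ⟨a, h₁, h₂⟩ ⟨b, h₃, h₄⟩
  obtain rfl := hA z a b h₁ h₃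
  exact hB a x y h₂ h₄

lemma IsBisection.comp {A B : SetRel X X} (hA : A.IsBisection) (hB : B.IsBisection) :
    (A ○ B).IsBisection :=
  ⟨hA.1.comp hB.1, by rw [inv_comp]; exact hB.2.comp hA.2⟩

end SetRel

/-! ### Rings of relations and their prime filters -/

/-- A ring of relations on `X` (closed under unions and differences) which contains the diagonal, is
closed under inverses and products, and in which every relation is covered by finitely many
bisections. -/
structure RelRing (X : Type u) where
  carrier : Set (SetRel X X)
  id_mem : SetRel.id ∈ carrier
  union_mem : ∀ {A B}, A ∈ carrier → B ∈ carrier → A ∪ B ∈ carrier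
  sdiff_mem : ∀ {A B}, A ∈ carrier → B ∈ carrier → A \ B ∈ carrier
  inv_mem : ∀ {A}, A ∈ carrier → SetRel.inv A ∈ carrier
  comp_mem : ∀ {A B}, A ∈ carrier → B ∈ carrier → A ○ B ∈ carrier
  exists_cover : ∀ A ∈ carrier, ∃ F : Set (SetRel X X), F.Finite ∧
    (∀ B ∈ F, B ∈ carrier ∧ B.IsBisection) ∧ A ⊆ ⋃₀ F

namespace RelRing

variable {X : Type u} (R : RelRing X)

variable {R} in
lemma inter_mem {A B : SetRel X X} (hA : A ∈ R.carrier) (hB : B ∈ R.carrier) :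
    A ∩ B ∈ R.carrier := by
  rw [← Set.sdiff_sdiff_right_self]
  exact R.sdiff_mem hA (R.sdiff_mem hA hB)

lemma empty_mem : (∅ : SetRel X X) ∈ R.carrier := by
  simpa using R.sdiff_mem R.id_mem R.id_mem

variable {R} in
lemma unitDom_mem {A : SetRel X X} (hA : A ∈ R.carrier) : A.unitDom ∈ R.carrier := by
  rw [SetRel.unitDom_eq]
  exact inter_mem (R.comp_mem hA (R.inv_mem hA)) R.id_mem

variable {R} in
lemma sUnion_mem {F : Set (SetRel X X)} (hF : F.Finite) (h : ∀ B ∈ F, B ∈ R.carrier) :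
    ⋃₀ F ∈ R.carrier := by
  induction F, hF using Set.Finite.induction_on with
  | empty => simpa using R.empty_mem
  | @insert a s _ _ ih =>
    rw [Set.sUnion_insert]
    exact R.union_mem (h _ (Set.mem_insert _ _)) (ih fun B hB => h B (Set.mem_insert_of_mem _ hB))

/-- A prime filter of a ring of relations. -/
@[ext]
structure Arrow where
  sets : Set (SetRel X X)
  sub : ∀ {A}, A ∈ sets → A ∈ R.carrier
  nonempty : ∃ A, A ∈ sets
  empty_notMem : (∅ : SetRel X X) ∉ sets
  mono : ∀ {A B}, A ∈ sets → B ∈ R.carrier → A ⊆ B → B ∈ sets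
  inter : ∀ {A B}, A ∈ sets → B ∈ sets → A ∩ B ∈ sets
  prime : ∀ {A B}, A ∈ R.carrier → B ∈ R.carrier → A ∪ B ∈ sets → A ∈ sets ∨ B ∈ sets

namespace Arrow

variable {R}

lemma exists_mem (γ : R.Arrow) {A : SetRel X X} (hA : A ∈ γ.sets) : ∃ p, p ∈ A := by
  by_contra! h
  exact γ.empty_notMem (Set.eq_empty_of_forall_notMem h ▸ hA)

/-- The ring need not have a largest element, so the ultrafilter dichotomy is stated relative to a
member B of the filter. -/
lemma mem_or_sdiff_mem (γ : R.Arrow) {A B : SetRel X X} (hA : A ∈ R.carrier) (hB : B ∈ γ.sets) :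
    A ∈ γ.sets ∨ B \ A ∈ γ.sets := by
  refine γ.prime hA (R.sdiff_mem (γ.sub hB) hA) ?_
  rw [Set.union_sdiff_self]
  exact γ.mono hB (R.union_mem hA (γ.sub hB)) Set.subset_union_right

/-- Relative complements make prime filters maximal. Hence each identity between arrows below needs
only one inclusion. -/
lemma eq_of_subset {γ δ : R.Arrow} (h : γ.sets ⊆ δ.sets) : γ = δ := by
  refine Arrow.ext (h.antisymm fun A hA => ?_)
  obtain ⟨B, hB⟩ := γ.nonempty
  refine (γ.mem_or_sdiff_mem (δ.sub hA) hB).resolve_right fun h' => δ.empty_notMem ?_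
  simpa using δ.inter hA (h h')

lemma exists_mem_of_subset_sUnion (γ : R.Arrow) {F : Set (SetRel X X)} (hF : F.Finite)
    (h : ∀ B ∈ F, B ∈ R.carrier) {A : SetRel X X} (hA : A ∈ γ.sets) (hAF : A ⊆ ⋃₀ F) :
    ∃ B ∈ F, B ∈ γ.sets := by
  replace hA := γ.mono hA (sUnion_mem hF h) hAF
  clear hAF
  induction F, hF using Set.Finite.induction_on with
  | empty => exact (γ.empty_notMem (by simpa using hA)).elim
  | @insert a s _ hs ih =>
    have h' : ∀ B ∈ s, B ∈ R.carrier := fun B hB => h B (Set.mem_insert_of_mem _ hB)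
    rw [Set.sUnion_insert] at hA
    rcases γ.prime (h _ (Set.mem_insert _ _)) (sUnion_mem hs h') hA with h₁ | h₁
    · exact ⟨a, Set.mem_insert _ _, h₁⟩
    · obtain ⟨B, hB, hB'⟩ := ih h' h₁
      exact ⟨B, Set.mem_insert_of_mem _ hB, hB'⟩

/-- Primality picks one bisection from a finite cover of A; intersecting with it shows that
bisections form a base of the filter. -/
lemma exists_isBisection_subset (γ : R.Arrow) {A : SetRel X X} (hA : A ∈ γ.sets) :
    ∃ B ∈ γ.sets, B ⊆ A ∧ B.IsBisection := by
  obtain ⟨F, hF, hFR, hAF⟩ := R.exists_cover A (γ.sub hA)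
  obtain ⟨B, hBF, hB⟩ := γ.exists_mem_of_subset_sUnion hF (fun B hB => (hFR B hB).1) hA hAF
  exact ⟨A ∩ B, γ.inter hA hB, Set.inter_subset_left,
    (hFR B hBF).2.mono Set.inter_subset_right⟩

/-- The prime filter of the relations containing a given point. -/
def principal (p : X × X) (hp : ∃ A ∈ R.carrier, p ∈ A) : R.Arrow where
  sets := {B | B ∈ R.carrier ∧ p ∈ B}
  sub h := h.1
  nonempty := hp
  empty_notMem h := h.2
  mono h hB hAB := ⟨hB, hAB h.2⟩
  inter h h' := ⟨inter_mem h.1 h'.1, h.2, h'.2⟩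
  prime hA hB h := h.2.imp (fun h => ⟨hA, h⟩) (fun h => ⟨hB, h⟩)

/-! ### The groupoid operations on prime filters -/

/-- The inverse of an arrow. -/
def inv (γ : R.Arrow) : R.Arrow where
  sets := {A | A.inv ∈ γ.sets}
  sub h := R.inv_mem (γ.sub h)
  nonempty := γ.nonempty.imp' SetRel.inv fun _ h => h
  empty_notMem h := γ.empty_notMem h
  mono h hB hAB := γ.mono h (R.inv_mem hB) (SetRel.inv_mono hAB)
  inter h h' := γ.inter h h'
  prime hA hB h := γ.prime (R.inv_mem hA) (R.inv_mem hB) h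

lemma inv_inv (γ : R.Arrow) : γ.inv.inv = γ := rfl

/-- The range of an arrow. -/
def t (γ : R.Arrow) : R.Arrow where
  sets := {C | C ∈ R.carrier ∧ ∃ A ∈ γ.sets, A.unitDom ⊆ C}
  sub h := h.1
  nonempty := by
    obtain ⟨A, hA⟩ := γ.nonempty
    exact ⟨A.unitDom, unitDom_mem (γ.sub hA), A, hA, subset_rfl⟩
  empty_notMem := by
    rintro ⟨-, A, hA, h⟩
    obtain ⟨⟨x, y⟩, hp⟩ := γ.exists_mem hA
    exact h (show (x, x) ∈ A.unitDom from ⟨rfl, y, hp⟩)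
  mono := fun ⟨_, A, hA, h⟩ hB hAB => ⟨hB, A, hA, h.trans hAB⟩
  inter := fun ⟨h₁, A, hA, h⟩ ⟨h₂, B, hB, h'⟩ => ⟨inter_mem h₁ h₂, A ∩ B, γ.inter hA hB,
    Set.subset_inter ((SetRel.unitDom_mono Set.inter_subset_left).trans h)
      ((SetRel.unitDom_mono Set.inter_subset_right).trans h')⟩
  prime := by
    rintro C D hC hD ⟨-, A, hA, h⟩
    -- Composing with the diagonal part of E restricts A to the points whose unit lies in E; the
    -- restrictions to C and D cover A.
    have key : ∀ E ∈ R.carrier, (E ∩ SetRel.id) ○ A ∈ γ.sets →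
        E ∈ R.carrier ∧ ∃ A ∈ γ.sets, A.unitDom ⊆ E := by
      refine fun E hE h => ⟨hE, _, h, ?_⟩
      rintro ⟨x, y⟩ ⟨rfl : x = y, z, w, ⟨hw, rfl : x = w⟩, -⟩
      exact hw
    refine (γ.prime (R.comp_mem (inter_mem hC R.id_mem) (γ.sub hA))
      (R.comp_mem (inter_mem hD R.id_mem) (γ.sub hA)) (γ.mono hA (R.union_mem
      (R.comp_mem (inter_mem hC R.id_mem) (γ.sub hA))
      (R.comp_mem (inter_mem hD R.id_mem) (γ.sub hA))) ?_)).imp (key C hC) (key D hD)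
    rintro ⟨x, y⟩ hxy
    exact (h (show (x, x) ∈ A.unitDom from ⟨rfl, y, hxy⟩)).imp
      (fun h => ⟨x, ⟨h, rfl⟩, hxy⟩) (fun h => ⟨x, ⟨h, rfl⟩, hxy⟩)

lemma unitDom_mem_t {γ : R.Arrow} {A : SetRel X X} (hA : A ∈ γ.sets) : A.unitDom ∈ γ.t.sets :=
  ⟨unitDom_mem (γ.sub hA), A, hA, subset_rfl⟩

/-- The source of an arrow. -/
def s (γ : R.Arrow) : R.Arrow := γ.inv.t

lemma unitDom_inv_mem_s {γ : R.Arrow} {A : SetRel X X} (hA : A ∈ γ.sets) :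
    A.inv.unitDom ∈ γ.s.sets := unitDom_mem_t (γ := γ.inv) hA

lemma t_inv (γ : R.Arrow) : γ.inv.t = γ.s := rfl

lemma s_inv (γ : R.Arrow) : γ.inv.s = γ.t := rfl

variable (R) in
/-- The units are the filters containing the diagonal. -/
def units : Set R.Arrow := {γ | SetRel.id ∈ γ.sets}

lemma t_mem (γ : R.Arrow) : γ.t ∈ units R := by
  obtain ⟨A, hA⟩ := γ.nonempty
  exact ⟨R.id_mem, A, hA, fun _ h => h.1⟩

lemma t_unit {γ : R.Arrow} (h : γ ∈ units R) : γ.t = γ := by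
  refine Eq.symm (eq_of_subset ?_)
  refine fun A hA => ⟨γ.sub hA, A ∩ SetRel.id, γ.inter hA h, ?_⟩
  rintro ⟨x, y⟩ ⟨rfl : x = y, z, hz, rfl : x = z⟩
  exact hz

lemma inv_unit {γ : R.Arrow} (h : γ ∈ units R) : γ.inv = γ := by
  refine Eq.symm (eq_of_subset ?_)
  refine fun A hA => γ.mono (A := A ∩ SetRel.id) (γ.inter hA h) (R.inv_mem (γ.sub hA)) ?_
  rintro ⟨x, y⟩ ⟨hz, rfl : x = y⟩
  exact hz

lemma s_unit {γ : R.Arrow} (h : γ ∈ units R) : γ.s = γ := by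
  rw [s, inv_unit h, t_unit h]

/-- The composable part of a member of `γ` is a member of `γ`. -/
lemma comp_unitDom_mem {γ δ : R.Arrow} (h : γ.s = δ.t) {A B : SetRel X X} (hA : A ∈ γ.sets)
    (hB : B ∈ δ.sets) : A ○ B.unitDom ∈ γ.sets := by
  have h₁ : B.unitDom ∈ γ.s.sets := h ▸ unitDom_mem_t hB
  obtain ⟨-, E, hE, hEB⟩ := h₁
  refine γ.mono (γ.inter hA hE) (R.comp_mem (γ.sub hA) (unitDom_mem (δ.sub hB))) ?_
  rintro ⟨x, y⟩ ⟨hxA, hxE⟩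
  exact ⟨y, hxA, hEB (show (y, y) ∈ E.unitDom from ⟨rfl, x, hxE⟩)⟩

/-- The product of two composable arrows. -/
def mul (γ δ : R.Arrow) (h : γ.s = δ.t) : R.Arrow where
  sets := {C | C ∈ R.carrier ∧ ∃ A ∈ γ.sets, ∃ B ∈ δ.sets, A ○ B ⊆ C}
  sub h := h.1
  nonempty := by
    obtain ⟨A, hA⟩ := γ.nonempty
    obtain ⟨B, hB⟩ := δ.nonempty
    exact ⟨A ○ B, R.comp_mem (γ.sub hA) (δ.sub hB), A, hA, B, hB, subset_rfl⟩
  empty_notMem := by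
    rintro ⟨-, A, hA, B, hB, hAB⟩
    obtain ⟨⟨x, y⟩, z, hz, rfl : z = y, w, hw⟩ := γ.exists_mem (comp_unitDom_mem h hA hB)
    exact hAB (show (x, w) ∈ A ○ B from ⟨z, hz, hw⟩)
  mono := fun ⟨_, A, hA, B, hB, h⟩ hC hCD => ⟨hC, A, hA, B, hB, h.trans hCD⟩
  inter := fun ⟨h₁, A, hA, B, hB, h⟩ ⟨h₂, A', hA', B', hB', h'⟩ =>
    ⟨inter_mem h₁ h₂, A ∩ A', γ.inter hA hA', B ∩ B', δ.inter hB hB', Set.subset_inter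
      ((SetRel.comp_subset_comp Set.inter_subset_left Set.inter_subset_left).trans h)
      ((SetRel.comp_subset_comp Set.inter_subset_right Set.inter_subset_right).trans h')⟩
  prime := by
    rintro C D hC hD ⟨-, A, hA, B₀, hB₀, hAB₀⟩
    -- With B single-valued, (E ∘ B⁻¹) ∘ B ⊆ E. So primality of γ, applied to the parts of A in C ∘
    -- B⁻¹ and D ∘ B⁻¹, decides between C and D.
    obtain ⟨B, hB, hBB₀, hBb⟩ := δ.exists_isBisection_subset hB₀
    have hAB := (SetRel.comp_subset_comp_right (R := A) hBB₀).trans hAB₀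
    have hR : ∀ E ∈ R.carrier, A ∩ (E ○ B.inv) ∈ R.carrier := fun E hE =>
      inter_mem (γ.sub hA) (R.comp_mem hE (R.inv_mem (δ.sub hB)))
    have key : ∀ E ∈ R.carrier, A ∩ (E ○ B.inv) ∈ γ.sets →
        E ∈ R.carrier ∧ ∃ A ∈ γ.sets, ∃ B ∈ δ.sets, A ○ B ⊆ E := by
      refine fun E hE h => ⟨hE, _, h, B, hB, ?_⟩
      rintro ⟨x, y⟩ ⟨z, ⟨-, w, hw, hzw⟩, hzy⟩
      rwa [hBb.1 z y w hzy hzw]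
    refine (γ.prime (hR C hC) (hR D hD) (γ.mono (comp_unitDom_mem h hA hB)
      (R.union_mem (hR C hC) (hR D hD)) ?_)).imp (key C hC) (key D hD)
    rintro ⟨x, y⟩ ⟨z, hz, rfl : z = y, w, hw⟩
    exact (hAB (show (x, w) ∈ A ○ B from ⟨z, hz, hw⟩)).imp
      (fun h => ⟨hz, w, h, hw⟩) (fun h => ⟨hz, w, h, hw⟩)

lemma comp_mem_mul {γ δ : R.Arrow} (h : γ.s = δ.t) {A B : SetRel X X} (hA : A ∈ γ.sets)
    (hB : B ∈ δ.sets) : A ○ B ∈ (γ.mul δ h).sets :=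
  ⟨R.comp_mem (γ.sub hA) (δ.sub hB), A, hA, B, hB, subset_rfl⟩

lemma t_mul {γ δ : R.Arrow} (h : γ.s = δ.t) : (γ.mul δ h).t = γ.t := by
  refine (eq_of_subset ?_).symm
  rintro C ⟨hC, A, hA, hAC⟩
  obtain ⟨B, hB⟩ := δ.nonempty
  refine ⟨hC, A ○ B, comp_mem_mul h hA hB, ?_⟩
  rintro ⟨x, y⟩ ⟨rfl : x = y, z, w, hw, -⟩
  exact hAC (show (x, x) ∈ A.unitDom from ⟨rfl, w, hw⟩)

lemma s_mul {γ δ : R.Arrow} (h : γ.s = δ.t) : (γ.mul δ h).s = δ.s := by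
  refine (eq_of_subset ?_).symm
  rintro C ⟨hC, B, hB, hBC⟩
  obtain ⟨A, hA⟩ := γ.nonempty
  refine ⟨hC, (A ○ B.inv).inv, comp_mem_mul h hA hB, ?_⟩
  rintro ⟨x, y⟩ ⟨rfl : x = y, z, w, -, hw⟩
  exact hBC (show (x, x) ∈ B.unitDom from ⟨rfl, w, hw⟩)

lemma unit_mul (γ : R.Arrow) (h : γ.t.s = γ.t) : γ.t.mul γ h = γ := by
  refine Eq.symm (eq_of_subset ?_)
  refine fun A hA => ⟨γ.sub hA, A.unitDom, unitDom_mem_t hA, A, hA, ?_⟩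
  rintro ⟨x, y⟩ ⟨z, ⟨rfl : x = z, -⟩, hz⟩
  exact hz

lemma mul_unit (γ : R.Arrow) (h : γ.s = γ.s.t) : γ.mul γ.s h = γ := by
  refine Eq.symm (eq_of_subset ?_)
  refine fun A hA => ⟨γ.sub hA, A, hA, A.inv.unitDom, unitDom_inv_mem_s hA, ?_⟩
  rintro ⟨x, y⟩ ⟨z, hz, rfl : z = y, -⟩
  exact hz

/-- For a bisection B, the product B ∘ B⁻¹ consists only of units over the domain of B. -/
lemma mul_inv (γ : R.Arrow) (h : γ.s = γ.inv.t) : γ.mul γ.inv h = γ.t := by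
  refine (eq_of_subset ?_).symm
  rintro C ⟨hC, A, hA, hAC⟩
  obtain ⟨B, hB, hBA, hBb⟩ := γ.exists_isBisection_subset hA
  refine ⟨hC, B, hB, B.inv, hB, ?_⟩
  rintro ⟨x, y⟩ ⟨z, hz, hz'⟩
  exact hAC ⟨hBb.2 z x y hz hz', z, hBA hz⟩

lemma mul_assoc {α β γ : R.Arrow} (h₁ : α.s = β.t) (h₂ : β.s = γ.t)
    (h₃ : (α.mul β h₁).s = γ.t) (h₄ : α.s = (β.mul γ h₂).t) :
    (α.mul β h₁).mul γ h₃ = α.mul (β.mul γ h₂) h₄ := by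
  refine eq_of_subset ?_
  rintro D ⟨hD, E, ⟨-, A, hA, B, hB, hAB⟩, C, hC, hEC⟩
  refine ⟨hD, A, hA, B ○ C, comp_mem_mul h₂ hB hC, ?_⟩
  rw [← SetRel.comp_assoc]
  exact (SetRel.comp_subset_comp_left hAB).trans hEC

variable (R) in
/-- The groupoid of arrows of a ring of relations. -/
def groupoid : GroupoidStr R.Arrow where
  units := units R
  t := t
  s := s
  mul q := mul q.1.1 q.1.2 q.2
  inv := inv
  t_mem := t_mem
  s_mem a := t_mem a.inv
  t_unit _ h := t_unit h
  s_unit _ h := s_unit h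
  t_mul q := t_mul q.2
  s_mul q := s_mul q.2
  t_inv := t_inv
  s_inv := s_inv
  unit_mul a := unit_mul a _
  mul_unit a := mul_unit a _
  mul_assoc _ _ _ h₁ h₂ := mul_assoc h₁ h₂ _ _
  mul_inv a := mul_inv a _
  inv_mul a := mul_inv a.inv _

/-! ### Lifting units and factoring arrows -/

/-- An arrow is determined by its range and a relation with single-valued elements. -/
lemma eq_of_t_eq {γ δ : R.Arrow} {A : SetRel X X} (hA : A.RightUnique) (hγ : A ∈ γ.sets)
    (hδ : A ∈ δ.sets) (h : γ.t = δ.t) : γ = δ := by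
  refine eq_of_subset fun D hD => ?_
  -- Over the domain of D ∩ A, the single value of A already lies in D; the common range makes this
  -- domain visible to δ.
  have h₁ : (D ∩ A).unitDom ∈ δ.t.sets := h ▸ unitDom_mem_t (γ.inter hD hγ)
  obtain ⟨-, E, hE, hED⟩ := h₁
  refine δ.mono (δ.inter hE hδ) (γ.sub hD) ?_
  rintro ⟨x, y⟩ ⟨hxE, hxA⟩
  obtain ⟨-, z, hzD, hzA⟩ := hED (show (x, x) ∈ E.unitDom from ⟨rfl, y, hxE⟩)
  rwa [hA x y z hxA hzA]

lemma eq_of_s_eq {γ δ : R.Arrow} {A : SetRel X X} (hA : A.inv.RightUnique) (hγ : A ∈ γ.sets)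
    (hδ : A ∈ δ.sets) (h : γ.s = δ.s) : γ = δ :=
  congrArg inv (eq_of_t_eq (γ := γ.inv) (δ := δ.inv) hA hγ hδ h)

/-- The lift consists of the D that agree with A over a set belonging to ω. Single-valuedness of A
makes D ↦ dom (D ∩ A) compatible with intersections, so this is a filter. -/
lemma exists_lift_of_rightUnique {ω : R.Arrow} {A : SetRel X X}
    (hA : A ∈ R.carrier) (hAu : A.RightUnique) (h : A.unitDom ∈ ω.sets) :
    ∃ γ : R.Arrow, A ∈ γ.sets ∧ γ.t = ω := by
  have hR : ∀ D ∈ R.carrier, (D ∩ A).unitDom ∈ R.carrier := fun D hD =>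
    unitDom_mem (inter_mem hD hA)
  let γ : R.Arrow :=
    { sets := {D | D ∈ R.carrier ∧ (D ∩ A).unitDom ∈ ω.sets}
      sub := fun h => h.1
      nonempty := ⟨A, hA, by rwa [Set.inter_self]⟩
      empty_notMem := by
        rintro ⟨-, h⟩
        obtain ⟨p, -, y, hy, -⟩ := ω.exists_mem h
        exact hy
      mono := fun h hB hAB => ⟨hB, ω.mono h.2 (hR _ hB)
        (SetRel.unitDom_mono (Set.inter_subset_inter_left _ hAB))⟩
      inter := by
        rintro C D ⟨hC, hC'⟩ ⟨hD, hD'⟩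
        refine ⟨inter_mem hC hD, ω.mono (ω.inter hC' hD') (hR _ (inter_mem hC hD)) ?_⟩
        rintro ⟨x, y⟩ ⟨⟨hxy, z, hzC, hzA⟩, -, w, hwD, hwA⟩
        obtain rfl := hAu x z w hzA hwA
        exact ⟨hxy, z, ⟨hzC, hwD⟩, hzA⟩
      prime := by
        rintro C D hC hD ⟨-, h⟩
        refine (ω.prime (hR C hC) (hR D hD) (ω.mono h (R.union_mem (hR C hC) (hR D hD)) ?_)).imp
          (fun h => ⟨hC, h⟩) (fun h => ⟨hD, h⟩)
        rintro ⟨x, y⟩ ⟨hxy, z, hz, hzA⟩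
        exact hz.imp (fun h => ⟨hxy, z, h, hzA⟩) (fun h => ⟨hxy, z, h, hzA⟩) }
  refine ⟨γ, ⟨hA, by rwa [Set.inter_self]⟩, eq_of_subset ?_⟩
  rintro C ⟨hC, D, ⟨-, hD⟩, hDC⟩
  exact ω.mono hD hC ((SetRel.unitDom_mono Set.inter_subset_left).trans hDC)

/-- The domains of the finitely many bisection pieces of A cover its domain, so ω contains the
domain of one piece. -/
lemma exists_lift {ω : R.Arrow} {A : SetRel X X}
    (hA : A ∈ R.carrier) (h : A.unitDom ∈ ω.sets) :
    ∃ γ : R.Arrow, A ∈ γ.sets ∧ γ.t = ω := by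
  obtain ⟨F, hF, hFR, hAF⟩ := R.exists_cover A hA
  obtain ⟨E, ⟨B, hB, rfl⟩, hE⟩ := ω.exists_mem_of_subset_sUnion
    (F := (fun B => (A ∩ B).unitDom) '' F) (hF.image _)
    (by rintro _ ⟨B, hB, rfl⟩; exact unitDom_mem (inter_mem hA (hFR B hB).1)) h (by
      rintro ⟨x, y⟩ ⟨hxy, z, hz⟩
      obtain ⟨B, hB, hzB⟩ := hAF hz
      exact ⟨_, ⟨B, hB, rfl⟩, hxy, z, hz, hzB⟩)
  obtain ⟨γ, hγ, hγω⟩ := exists_lift_of_rightUnique (inter_mem hA (hFR B hB).1)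
    ((hFR B hB).2.1.mono Set.inter_subset_right) hE
  exact ⟨γ, γ.mono hγ hA Set.inter_subset_left, hγω⟩

/-- An arrow containing a product is a product. -/
lemma exists_mul_of_comp_mem {γ : R.Arrow} {A B : SetRel X X} (hA : A ∈ R.carrier)
    (hB : B ∈ R.carrier) (h : A ○ B ∈ γ.sets) :
    ∃ (α β : R.Arrow) (hαβ : α.s = β.t), A ∈ α.sets ∧ B ∈ β.sets ∧ α.mul β hαβ = γ := by
  obtain ⟨F, hF, hFR, hAF⟩ := R.exists_cover A hA
  obtain ⟨E, ⟨D, hD, rfl⟩, hE⟩ := γ.exists_mem_of_subset_sUnion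
    (F := (fun D => (A ∩ D) ○ B) '' F) (hF.image _)
    (by rintro _ ⟨D, hD, rfl⟩; exact R.comp_mem (inter_mem hA (hFR D hD).1) hB) h (by
      rintro ⟨x, y⟩ ⟨z, hz, hzB⟩
      obtain ⟨D, hD, hzD⟩ := hAF hz
      exact ⟨_, ⟨D, hD, rfl⟩, z, ⟨hz, hzD⟩, hzB⟩)
  have hAD : A ∩ D ∈ R.carrier := inter_mem hA (hFR D hD).1
  have hDu := (hFR D hD).2
  -- Lift the range of γ through the bisection A ∩ D; the second factor must then be α⁻¹γ. It
  -- contains B because (A ∩ D)⁻¹ ∘ ((A ∩ D) ∘ B) ⊆ B.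
  obtain ⟨α, hα, hαγ⟩ := exists_lift hAD (γ.t.mono (unitDom_mem_t hE)
    (unitDom_mem hAD) (by
      rintro ⟨x, y⟩ ⟨hxy, z, w, hw, -⟩
      exact ⟨hxy, w, hw⟩))
  have h₁ : α.inv.s = γ.t := hαγ
  have h₂ : α.s = (α.inv.mul γ h₁).t := (t_mul h₁).symm
  refine ⟨α, α.inv.mul γ h₁, h₂, α.mono hα hA Set.inter_subset_left,
    ⟨hB, (A ∩ D).inv, hα, _, hE, ?_⟩, ?_⟩
  · rintro ⟨x, y⟩ ⟨z, hz, w, hw, hwB⟩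
    rwa [hDu.1 z x w hz.2 hw.2]
  · refine eq_of_subset ?_
    rintro C ⟨hC, E, hE, G, ⟨-, E', hE', K, hK, hEK⟩, hEG⟩
    have h₃ : (E ∩ E'.inv).unitDom ∈ γ.t.sets := hαγ ▸ unitDom_mem_t (α.inter hE hE')
    obtain ⟨-, K', hK', hKE⟩ := h₃
    refine γ.mono (γ.inter hK hK') hC ?_
    rintro ⟨x, y⟩ ⟨hxK, hxK'⟩
    obtain ⟨-, z, hzE, hzE'⟩ := hKE (show (x, x) ∈ K'.unitDom from ⟨rfl, y, hxK'⟩)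
    exact hEG ⟨z, hzE, hEK ⟨x, hzE', hxK⟩⟩

end Arrow

end RelRing

/-! ### Topology of the arrow space -/

namespace RelRing.Arrow

variable {X : Type u} {R : RelRing X}

variable (R) in
/-- The set of arrows containing a relation. -/
def basic (A : SetRel X X) : Set R.Arrow := {γ | A ∈ γ.sets}

instance : TopologicalSpace R.Arrow :=
  TopologicalSpace.generateFrom (basic R '' R.carrier)

lemma isTopologicalBasis : TopologicalSpace.IsTopologicalBasis (basic R '' R.carrier) where
  exists_subset_inter := by
    rintro _ ⟨A, hA, rfl⟩ _ ⟨B, hB, rfl⟩ γ hγ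
    exact ⟨_, ⟨A ∩ B, inter_mem hA hB, rfl⟩, γ.inter hγ.1 hγ.2, fun δ hδ =>
      ⟨δ.mono hδ hA Set.inter_subset_left, δ.mono hδ hB Set.inter_subset_right⟩⟩
  sUnion_eq := Set.eq_univ_of_forall fun γ => by
    obtain ⟨A, hA⟩ := γ.nonempty
    exact ⟨_, ⟨A, γ.sub hA, rfl⟩, hA⟩
  eq_generateFrom := rfl

lemma isOpen_basic {A : SetRel X X} (hA : A ∈ R.carrier) : IsOpen (basic R A) :=
  isTopologicalBasis.isOpen ⟨A, hA, rfl⟩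

lemma mem_nhds_iff {γ : R.Arrow} {U : Set R.Arrow} :
    U ∈ 𝓝 γ ↔ ∃ A ∈ γ.sets, basic R A ⊆ U := by
  rw [isTopologicalBasis.mem_nhds_iff]
  constructor
  · rintro ⟨_, ⟨A, -, rfl⟩, hA, hU⟩
    exact ⟨A, hA, hU⟩
  · rintro ⟨A, hA, hU⟩
    exact ⟨_, ⟨A, γ.sub hA, rfl⟩, hA, hU⟩

lemma basic_mem_nhds {γ : R.Arrow} {A : SetRel X X} (hA : A ∈ γ.sets) : basic R A ∈ 𝓝 γ :=
  mem_nhds_iff.2 ⟨A, hA, subset_rfl⟩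

instance : T2Space R.Arrow := by
  refine (t2Space_iff _).2 fun γ δ hne => ?_
  have h : ¬ γ.sets ⊆ δ.sets := fun h => hne (eq_of_subset h)
  obtain ⟨A, hA, hA'⟩ := Set.not_subset.1 h
  obtain ⟨B, hB⟩ := δ.nonempty
  have hBA := (δ.mem_or_sdiff_mem (γ.sub hA) hB).resolve_left hA'
  refine ⟨_, _, isOpen_basic (γ.sub hA), isOpen_basic (δ.sub hBA), hA, hBA, ?_⟩
  refine Set.disjoint_left.2 fun ε h₁ h₂ => ε.empty_notMem ?_
  simpa using ε.inter h₁ h₂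

/-- An ultrafilter 𝒰 on arrows converges to the prime filter of those B for which 𝒰-almost every
arrow contains B; A itself ensures that this filter is nonempty. -/
lemma isCompact_basic {A : SetRel X X} (hA : A ∈ R.carrier) : IsCompact (basic R A) := by
  refine isCompact_iff_ultrafilter_le_nhds.2 fun 𝒰 h𝒰 => ?_
  replace h𝒰 : basic R A ∈ 𝒰 := Filter.le_principal_iff.1 h𝒰
  let γ : R.Arrow :=
    { sets := {B | B ∈ R.carrier ∧ basic R B ∈ 𝒰}
      sub := fun h => h.1
      nonempty := ⟨A, hA, h𝒰⟩
      empty_notMem := by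
        rintro ⟨-, h⟩
        obtain ⟨γ, hγ⟩ := 𝒰.nonempty_of_mem h
        exact γ.empty_notMem hγ
      mono := fun h hB hAB => ⟨hB, Filter.mem_of_superset h.2 fun γ hγ => γ.mono hγ hB hAB⟩
      inter := fun h h' => ⟨inter_mem h.1 h'.1,
        Filter.mem_of_superset (Filter.inter_mem h.2 h'.2) fun γ hγ => γ.inter hγ.1 hγ.2⟩
      prime := fun hB hC h => (Ultrafilter.union_mem_iff.1 (Filter.mem_of_superset h.2
        fun γ hγ => γ.prime hB hC hγ)).imp (fun h => ⟨hB, h⟩) (fun h => ⟨hC, h⟩) }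
  refine ⟨γ, ⟨hA, h𝒰⟩, fun U hU => ?_⟩
  obtain ⟨B, hB, hBU⟩ := mem_nhds_iff.1 hU
  exact Filter.mem_of_superset hB.2 hBU

instance : LocallyCompactSpace R.Arrow :=
  haveI : WeaklyLocallyCompactSpace R.Arrow := ⟨fun γ => by
    obtain ⟨A, hA⟩ := γ.nonempty
    exact ⟨_, isCompact_basic (γ.sub hA), basic_mem_nhds hA⟩⟩
  inferInstance

lemma secondCountableTopology (hR : R.carrier.Countable) : SecondCountableTopology R.Arrow :=
  isTopologicalBasis.secondCountableTopology (hR.image _)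

lemma continuous_inv : Continuous (inv : R.Arrow → R.Arrow) := by
  refine continuous_iff_continuousAt.2 fun γ U hU => ?_
  obtain ⟨A, hA, hAU⟩ := mem_nhds_iff.1 hU
  exact mem_nhds_iff.2 ⟨A.inv, hA, fun δ hδ => hAU hδ⟩

/-- Membership in the range is witnessed by a single member A, which serves for every arrow
containing A. Continuity of the product has the same reason. -/
lemma continuous_t : Continuous (t : R.Arrow → R.Arrow) := by
  refine continuous_iff_continuousAt.2 fun γ U hU => ?_
  obtain ⟨C, ⟨hC, A, hA, hAC⟩, hCU⟩ := mem_nhds_iff.1 hU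
  exact mem_nhds_iff.2 ⟨A, hA, fun δ hδ => hCU ⟨hC, A, hδ, hAC⟩⟩

lemma continuous_mul : Continuous (groupoid R).mul := by
  refine continuous_iff_continuousAt.2 fun q U hU => ?_
  obtain ⟨C, ⟨hC, A, hA, B, hB, hABC⟩, hCU⟩ := mem_nhds_iff.1 hU
  refine Filter.mem_map.2 <| Filter.mem_of_superset
    (continuous_subtype_val.continuousAt.preimage_mem_nhds
      (prod_mem_nhds (basic_mem_nhds hA) (basic_mem_nhds hB))) fun q' hq' => hCU ?_
  exact ⟨hC, A, hq'.1, B, hq'.2, hABC⟩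

/-- By lifting, the arrows containing A map onto all units containing the domain of A. -/
lemma isOpenMap_t : IsOpenMap (fun γ : R.Arrow => (⟨γ.t, γ.t_mem⟩ : units R)) := by
  refine isTopologicalBasis.isOpenMap_iff.2 ?_
  rintro _ ⟨A, hA, rfl⟩
  refine ⟨basic R A.unitDom, isOpen_basic (unitDom_mem hA), ?_⟩
  ext ω
  constructor
  · intro h
    obtain ⟨γ, hγ, hγω⟩ := exists_lift hA h
    exact ⟨γ, hγ, Subtype.ext hγω⟩
  · rintro ⟨γ, hγ, rfl⟩
    exact unitDom_mem_t hγ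

lemma isLocalHomeomorph_t :
    IsLocalHomeomorph (fun γ : R.Arrow => (⟨γ.t, γ.t_mem⟩ : units R)) := by
  refine isLocalHomeomorph_iff_isOpenEmbedding_restrict.2 fun γ => ?_
  obtain ⟨A, hA⟩ := γ.nonempty
  obtain ⟨B, hB, -, hBb⟩ := γ.exists_isBisection_subset hA
  refine ⟨basic R B, basic_mem_nhds hB, .of_continuous_injective_isOpenMap ?_ ?_ ?_⟩
  · exact (continuous_t.subtype_mk _).comp continuous_subtype_val
  · rintro ⟨δ, hδ⟩ ⟨ε, hε⟩ h
    exact Subtype.ext (eq_of_t_eq hBb.1 hδ hε (congrArg Subtype.val h))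
  · exact isOpenMap_t.comp (isOpen_basic (γ.sub hB)).isOpenMap_subtype_val

variable (R) in
/-- Inversion as a homeomorphism. -/
def invHomeomorph : R.Arrow ≃ₜ R.Arrow where
  toFun := inv
  invFun := inv
  left_inv := inv_inv
  right_inv := inv_inv
  continuous_toFun := continuous_inv
  continuous_invFun := continuous_inv

lemma isEtale : (groupoid R).IsEtale where
  continuous_mul := continuous_mul
  continuous_inv := continuous_inv
  t_local := isLocalHomeomorph_t
  s_local := isLocalHomeomorph_t.comp (invHomeomorph R).isLocalHomeomorph

/-- Compact sets are closed, which bounds the closure; density holds because any B ∩ A in a filter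
is nonempty and each of its points gives a point arrow. -/
lemma closure_image_principal {S : Set (X × X)} (hS : ∀ p : S, ∃ A ∈ R.carrier, (p : X × X) ∈ A)
    {A : SetRel X X} (hA : A ∈ R.carrier) (hAS : A ⊆ S) :
    closure ((fun p : S => principal p (hS p)) '' {p | (p : X × X) ∈ A}) = basic R A := by
  refine Set.Subset.antisymm (closure_minimal ?_ (isCompact_basic hA).isClosed) fun γ hγ => ?_
  · rintro _ ⟨p, hp, rfl⟩
    exact ⟨hA, hp⟩
  · refine mem_closure_iff_nhds.2 fun U hU => ?_
    obtain ⟨B, hB, hBU⟩ := mem_nhds_iff.1 hU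
    obtain ⟨p, hpB, hpA⟩ := γ.exists_mem (γ.inter hB hγ)
    refine ⟨principal p (hS ⟨p, hAS hpA⟩), hBU ?_, ⟨p, hAS hpA⟩, hpA, rfl⟩
    exact And.intro (γ.sub hB) hpB

end RelRing.Arrow

/-! ### Point arrows, extension of functions, generation -/

namespace RelRing

variable {X : Type u} {R : RelRing X}

lemma npow_mem {T : SetRel X X} (hT : T ∈ R.carrier) (n : ℕ) :
    SetRel.npow (T.inv ∪ T) n ∈ R.carrier := by
  induction n with
  | zero => exact R.id_mem
  | succ n ih => exact R.comp_mem ih (R.union_mem (R.inv_mem hT) hT)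

namespace Arrow

lemma t_principal {x y : X} (hp : ∃ A ∈ R.carrier, (x, y) ∈ A) :
    (principal (x, y) hp).t = principal (x, x) ⟨_, R.id_mem, rfl⟩ := by
  refine eq_of_subset ?_
  rintro C ⟨hC, A, ⟨-, hA⟩, hAC⟩
  exact ⟨hC, hAC ⟨rfl, y, hA⟩⟩

lemma s_principal {x y : X} (hp : ∃ A ∈ R.carrier, (x, y) ∈ A) :
    (principal (x, y) hp).s = principal (y, y) ⟨_, R.id_mem, rfl⟩ := by
  refine eq_of_subset ?_
  rintro C ⟨hC, A, ⟨-, hA⟩, hAC⟩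
  exact ⟨hC, hAC ⟨rfl, x, hA⟩⟩

lemma mul_principal {x y z : X} (h₁ : ∃ A ∈ R.carrier, (x, y) ∈ A)
    (h₂ : ∃ A ∈ R.carrier, (y, z) ∈ A) (h₃ : ∃ A ∈ R.carrier, (x, z) ∈ A)
    (h : (principal (x, y) h₁).s = (principal (y, z) h₂).t) :
    (principal (x, y) h₁).mul (principal (y, z) h₂) h = principal (x, z) h₃ := by
  refine eq_of_subset ?_
  rintro C ⟨hC, A, ⟨-, hA⟩, B, ⟨-, hB⟩, hAB⟩
  exact ⟨hC, hAB ⟨y, hA, hB⟩⟩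

/-- A bisection in γ has x in its domain, hence contains some (x, z). The arrow of (x, z) shares
this bisection and the range with γ. -/
lemma eq_principal_of_t_eq {γ : R.Arrow} {x : X}
    (h : γ.t = principal (x, x) ⟨_, R.id_mem, rfl⟩) :
    ∃ (z : X) (hz : ∃ A ∈ R.carrier, (x, z) ∈ A), γ = principal (x, z) hz := by
  obtain ⟨A, hA⟩ := γ.nonempty
  obtain ⟨B, hB, -, hBb⟩ := γ.exists_isBisection_subset hA
  have h₁ : B.unitDom ∈ (principal (R := R) (x, x) ⟨_, R.id_mem, rfl⟩).sets :=
    h ▸ unitDom_mem_t hB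
  obtain ⟨-, -, z, hz⟩ := h₁
  exact ⟨z, ⟨B, γ.sub hB, hz⟩, eq_of_t_eq hBb.1 hB ⟨γ.sub hB, hz⟩ (h.trans (t_principal _).symm)⟩

lemma eq_principal_of_s_eq {γ : R.Arrow} {y : X}
    (h : γ.s = principal (y, y) ⟨_, R.id_mem, rfl⟩) :
    ∃ (z : X) (hz : ∃ A ∈ R.carrier, (z, y) ∈ A), γ = principal (z, y) hz := by
  obtain ⟨z, ⟨A, hA, hzA⟩, hz⟩ := eq_principal_of_t_eq (γ := γ.inv) h
  exact ⟨z, ⟨A.inv, R.inv_mem hA, hzA⟩, (inv_inv γ).symm.trans ((congrArg inv hz).trans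
    (eq_of_subset fun B hB => ⟨R.inv_mem hB.1, hB.2⟩))⟩

/-- A function whose level sets cut `R` into members of `R` extends continuously to the arrows. -/
lemma exists_continuous_extension {S : Set (X × X)}
    (hS : ∀ p : S, ∃ A ∈ R.carrier, (p : X × X) ∈ A) (h : S → ℝ≥0∞) {Q : Set ℝ≥0∞} (hQ : Dense Q)
    (hR : ∀ A ∈ R.carrier, ∀ q ∈ Q, A ∩ {p | ∃ hp : p ∈ S, q < h ⟨p, hp⟩} ∈ R.carrier) :
    ∃ H : R.Arrow → ℝ≥0∞, Continuous H ∧ ∀ p : S, H (principal p (hS p)) = h p := by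
  set L : ℝ≥0∞ → Set (X × X) := fun q => {p | ∃ hp : p ∈ S, q < h ⟨p, hp⟩}
  -- The extension is the supremum of the q in Q such that h > q on a whole member of γ.
  let K : R.Arrow → Set ℝ≥0∞ := fun γ => {q | q ∈ Q ∧ ∃ A ∈ γ.sets, A ⊆ L q}
  have hK : ∀ γ : R.Arrow, ∀ A, ∀ q ∈ Q, A ∩ L q ∈ γ.sets → q ∈ K γ :=
    fun γ A q hq h => ⟨hq, _, h, Set.inter_subset_right⟩
  refine ⟨fun γ => sSup (K γ), OrderTopology.continuous_iff.2 fun a => ⟨?_, ?_⟩, fun p => ?_⟩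
  · refine isOpen_iff_mem_nhds.2 fun γ hγ => ?_
    obtain ⟨q, ⟨hqQ, A, hA, hAq⟩, haq⟩ := lt_sSup_iff.1 (show a < sSup (K γ) from hγ)
    exact mem_nhds_iff.2 ⟨A, hA, fun δ hδ => haq.trans_le (le_sSup ⟨hqQ, A, hδ, hAq⟩)⟩
  · refine isOpen_iff_mem_nhds.2 fun γ hγ => ?_
    obtain ⟨q, hqQ, hγq, hqa⟩ := hQ.exists_between (show sSup (K γ) < a from hγ)
    obtain ⟨A, hA⟩ := γ.nonempty
    -- Since q exceeds the supremum, γ contains a relation on which h ≤ q; this bounds the value by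
    -- q at every arrow containing it.
    have h₁ : A \ (A ∩ L q) ∈ γ.sets :=
      (γ.mem_or_sdiff_mem (hR A (γ.sub hA) q hqQ) hA).resolve_left
        fun h => (le_sSup (hK γ A q hqQ h)).not_gt hγq
    refine mem_nhds_iff.2 ⟨_, h₁, fun δ hδ => lt_of_le_of_lt (sSup_le ?_) hqa⟩
    rintro q' ⟨-, B, hB, hBq⟩
    by_contra! hqq
    obtain ⟨p, hp, hpA, hpq⟩ := δ.exists_mem (δ.inter hB hδ)
    obtain ⟨hpS, hlt⟩ := hBq hp
    exact hpq ⟨hpA, hpS, hqq.trans hlt⟩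
  · refine le_antisymm (sSup_le ?_) (le_of_forall_lt fun a ha => ?_)
    · rintro q ⟨-, A, ⟨-, hpA⟩, hA⟩
      exact (hA hpA).2.le
    · obtain ⟨q, hqQ, haq, hqp⟩ := hQ.exists_between ha
      obtain ⟨A, hA, hpA⟩ := hS p
      refine haq.trans_le (le_sSup (hK (principal p (hS p)) A q hqQ ?_))
      exact And.intro (hR A hA q hqQ) ⟨hpA, p.2, hqp⟩

/-- Each arrow contains a power of T⁻¹ ∪ T, so it factors into arrows containing T⁻¹ ∪ T; by
primality each factor or its inverse contains some `φ j`. -/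
lemma isGeneratedBy {T : SetRel X X} (hT : T ∈ R.carrier)
    (hR : ∀ A ∈ R.carrier, ∃ n, A ⊆ SetRel.npow (T.inv ∪ T) n) {k : ℕ}
    {φ : Fin (k + 1) → SetRel X X} (hφ : IsLabel T φ) (hφR : ∀ j, φ j ∈ R.carrier) :
    (groupoid R).IsGeneratedBy (⋃ j, basic R (φ j)) := by
  intro S hS hφS
  have hTS : ∀ γ : R.Arrow, T ∈ γ.sets → γ ∈ S := fun γ hγ => by
    obtain ⟨_, ⟨j, rfl⟩, hj⟩ := γ.exists_mem_of_subset_sUnion (Set.finite_range φ)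
      (by rintro _ ⟨j, rfl⟩; exact hφR j) hγ (by rw [Set.sUnion_range, hφ.iUnion])
    exact hφS (Set.mem_iUnion.2 ⟨j, hj⟩)
  have hU : T.inv ∪ T ∈ R.carrier := R.union_mem (R.inv_mem hT) hT
  have key : ∀ n, ∀ γ : R.Arrow, SetRel.npow (T.inv ∪ T) n ∈ γ.sets → γ ∈ S := fun n => by
    induction n with
    | zero => exact fun γ hγ => hφS (Set.mem_iUnion.2 ⟨0, by rw [hφ.zero]; exact hγ⟩)
    | succ n ih =>
      intro γ hγ
      obtain ⟨α, β, hαβ, hα, hβ, rfl⟩ := exists_mul_of_comp_mem (npow_mem hT n) hU hγ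
      refine hS.mul_mem ⟨(α, β), hαβ⟩ (ih α hα) ?_
      rcases β.prime (R.inv_mem hT) hT hβ with h | h
      · exact hS.inv_mem β.inv (hTS β.inv h)
      · exact hTS β h
  refine Set.eq_univ_of_forall fun γ => ?_
  obtain ⟨A, hA⟩ := γ.nonempty
  obtain ⟨n, hAn⟩ := hR A (γ.sub hA)
  exact key n γ (γ.mono hA (npow_mem hT n) hAn)

end Arrow

end RelRing

/-! ### Constructing the countable ring -/

/-- A countable set generates a countable set under countably many binary operations. -/
lemma Set.Countable.exists_closed_superset {α : Type*} {s : Set α} (hs : s.Countable)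
    {F : Set (α → α → α)} (hF : F.Countable) {P : Set α} (hsP : s ⊆ P)
    (hP : ∀ f ∈ F, ∀ a ∈ P, ∀ b ∈ P, f a b ∈ P) :
    ∃ t, s ⊆ t ∧ t ⊆ P ∧ t.Countable ∧ ∀ f ∈ F, ∀ a ∈ t, ∀ b ∈ t, f a b ∈ t := by
  let u : ℕ → Set α := fun n => n.rec s fun _ t => t ∪ ⋃ f ∈ F, Set.image2 f t t
  have hu : ∀ n, u (n + 1) = u n ∪ ⋃ f ∈ F, Set.image2 f (u n) (u n) := fun _ => rfl
  have hmono : Monotone u := monotone_nat_of_le_succ fun n => by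
    rw [hu]; exact Set.subset_union_left
  refine ⟨⋃ n, u n, Set.subset_iUnion u 0, Set.iUnion_subset fun n => ?_,
    Set.countable_iUnion fun n => ?_, fun f hf a ha b hb => ?_⟩
  · induction n with
    | zero => exact hsP
    | succ n ih =>
      rw [hu]
      refine Set.union_subset ih (Set.iUnion₂_subset fun f hf => ?_)
      rintro _ ⟨a, ha, b, hb, rfl⟩
      exact hP f hf a (ih ha) b (ih hb)
  · induction n with
    | zero => exact hs
    | succ n ih =>
      rw [hu]
      exact ih.union (hF.biUnion fun f _ => ih.image2 ih f)
  · obtain ⟨m, hm⟩ := Set.mem_iUnion.1 ha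
    obtain ⟨n, hn⟩ := Set.mem_iUnion.1 hb
    refine Set.mem_iUnion.2 ⟨max m n + 1, ?_⟩
    rw [hu]
    exact Or.inr (Set.mem_iUnion₂.2 ⟨f, hf, a, hmono (le_max_left m n) hm, b,
      hmono (le_max_right m n) hn, rfl⟩)

lemma IsLabel.isBisection {X : Type u} {T : SetRel X X} {k : ℕ} {φ : Fin (k + 1) → SetRel X X}
    (hφ : IsLabel T φ) (j : Fin (k + 1)) : (φ j).IsBisection :=
  ⟨hφ.right_unique j, hφ.left_unique j⟩

/-- The relations of a labelled coarse structure contain a countable ring of relations which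
contains the label and is stable under intersection with countably many given sets. -/
lemma CoarseStructure.exists_relRing {X : Type u} (𝒞 : CoarseStructure X) {T : SetRel X X}
    (hT : 𝒞.IsGeneratedBy T) {k : ℕ} {φ : Fin (k + 1) → SetRel X X}
    (hφ : IsLabel T φ) {ℒ : Set (Set (X × X))} (hℒ : ℒ.Countable) :
    ∃ R : RelRing X, R.carrier.Countable ∧ T ∈ R.carrier ∧ (∀ j, φ j ∈ R.carrier) ∧
      (∀ A ∈ R.carrier, ∀ L ∈ ℒ, A ∩ L ∈ R.carrier) ∧ R.carrier ⊆ 𝒞.controlled ∧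
      ∀ A ∈ R.carrier, ∃ n, A ⊆ SetRel.npow (T.inv ∪ T) n := by
  have hT𝒞 : T ∈ 𝒞.controlled := (hT T).2 ⟨1, fun ⟨x, y⟩ h => ⟨x, rfl, Or.inr h⟩⟩
  have hφT : ∀ j, φ j ⊆ T := fun j => by rw [hφ.iUnion]; exact Set.subset_iUnion φ j
  -- Unary operations are encoded as binary ones ignoring their second argument.
  let F : Set (SetRel X X → SetRel X X → SetRel X X) :=
    {fun A B => A ∪ B, fun A B => A \ B, fun A _ => A.inv, fun A B => A ○ B} ∪
      (fun L A _ => A ∩ L) '' ℒ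
  have hF : F.Countable := (Set.toFinite _).countable.union (hℒ.image _)
  obtain ⟨t, hst, htP, htc, htF⟩ := Set.Countable.exists_closed_superset
    (s := insert T (Set.range φ)) ((Set.finite_range φ).insert T).countable hF
    (P := 𝒞.controlled) (by
      rintro _ (rfl | ⟨j, rfl⟩)
      · exact hT𝒞
      · exact 𝒞.subset_mem (hφT j) hT𝒞) (by
      rintro f ((rfl | rfl | rfl | rfl) | ⟨L, -, rfl⟩) A hA B hB
      · exact 𝒞.union_mem hA hB
      · exact 𝒞.subset_mem Set.sdiff_subset hA
      · exact 𝒞.inv_mem hA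
      · exact 𝒞.comp_mem hA hB
      · exact 𝒞.subset_mem Set.inter_subset_left hA)
  have hφt : ∀ j, φ j ∈ t := fun j => hst (Or.inr ⟨j, rfl⟩)
  have hinv : ∀ A ∈ t, A.inv ∈ t := fun A hA => htF (fun A _ => A.inv) (by simp [F]) A hA A hA
  have hcomp : ∀ A ∈ t, ∀ B ∈ t, A ○ B ∈ t := htF (fun A B => A ○ B) (by simp [F])
  -- The n-th power is covered by the words of length n in the `φ j` and their inverses, finitely
  -- many products of bisections.
  have hnpow : ∀ n, ∃ G : Set (SetRel X X), G.Finite ∧ (∀ B ∈ G, B ∈ t ∧ B.IsBisection) ∧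
      SetRel.npow (T.inv ∪ T) n ⊆ ⋃₀ G := fun n => by
    induction n with
    | zero =>
      refine ⟨{φ 0}, Set.finite_singleton _, ?_, ?_⟩
      · rintro _ rfl
        exact ⟨hφt 0, hφ.isBisection 0⟩
      · rw [Set.sUnion_singleton, hφ.zero]
        exact subset_rfl
    | succ n ih =>
      obtain ⟨G, hG, hGt, hnG⟩ := ih
      refine ⟨Set.image2 (fun A B => A ○ B) G
        (Set.range (fun j => (φ j).inv) ∪ Set.range φ),
        hG.image2 _ ((Set.finite_range _).union (Set.finite_range _)), ?_, ?_⟩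
      · rintro _ ⟨A, hA, B, ⟨j, rfl⟩ | ⟨j, rfl⟩, rfl⟩
        · exact ⟨hcomp A (hGt A hA).1 _ (hinv _ (hφt j)),
            (hGt A hA).2.comp (hφ.isBisection j).inv⟩
        · exact ⟨hcomp A (hGt A hA).1 _ (hφt j), (hGt A hA).2.comp (hφ.isBisection j)⟩
      · rintro ⟨x, y⟩ ⟨z, hz, hzy⟩
        obtain ⟨A, hA, hzA⟩ := hnG hz
        rw [hφ.iUnion] at hzy
        rcases hzy with h | h
        · obtain ⟨j, hj⟩ := Set.mem_iUnion.1 (show (y, z) ∈ ⋃ j, φ j from h)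
          exact ⟨_, ⟨A, hA, _, Or.inl ⟨j, rfl⟩, rfl⟩, z, hzA, hj⟩
        · obtain ⟨j, hj⟩ := Set.mem_iUnion.1 h
          exact ⟨_, ⟨A, hA, _, Or.inr ⟨j, rfl⟩, rfl⟩, z, hzA, hj⟩
  let R : RelRing X :=
    { carrier := t
      id_mem := hφ.zero ▸ hφt 0
      union_mem := fun {A B} hA hB => htF (fun A B => A ∪ B) (by simp [F]) A hA B hB
      sdiff_mem := fun {A B} hA hB => htF (fun A B => A \ B) (by simp [F]) A hA B hB
      inv_mem := fun {A} hA => hinv A hA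
      comp_mem := fun {A B} hA hB => hcomp A hA B hB
      exists_cover := fun A hA => by
        obtain ⟨n, hn⟩ := (hT A).1 (htP hA)
        obtain ⟨G, hG, hGt, hnG⟩ := hnpow n
        exact ⟨G, hG, hGt, hn.trans hnG⟩ }
  exact ⟨R, htc, hst (Or.inl rfl), hφt, fun A hA L hL => htF (fun A _ => A ∩ L)
    (Or.inr ⟨L, hL, rfl⟩) A hA A hA, htP, fun A hA => (hT A).1 (htP hA)⟩

/-! ### Indicator functions and the algebra they generate -/

section Indicator

variable {α : Type*} {S : Set α}

open scoped Classical in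
/-- The indicator function of `A`, as a bounded function on `S`. -/
noncomputable def lpIndicator (S A : Set α) : lp (fun _ : S => ℂ) ∞ :=
  ⟨fun p => if (p : α) ∈ A then 1 else 0, memℓp_infty ⟨1, by
    rintro _ ⟨p, rfl⟩
    dsimp only
    split_ifs <;> simp⟩⟩

lemma lpIndicator_apply_of_mem {A : Set α} {p : S} (hp : (p : α) ∈ A) : lpIndicator S A p = 1 :=
  if_pos hp

lemma lpIndicator_apply_of_notMem {A : Set α} {p : S} (hp : (p : α) ∉ A) :
    lpIndicator S A p = 0 :=
  if_neg hp

lemma lpIndicator_mul (A B : Set α) :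
    lpIndicator S A * lpIndicator S B = lpIndicator S (A ∩ B) := by
  ext p
  rw [lp.infty_coeFn_mul, Pi.mul_apply]
  by_cases hA : (p : α) ∈ A
  · by_cases hB : (p : α) ∈ B
    · rw [lpIndicator_apply_of_mem hA, lpIndicator_apply_of_mem hB,
        lpIndicator_apply_of_mem (A := A ∩ B) ⟨hA, hB⟩, one_mul]
    · rw [lpIndicator_apply_of_notMem hB, lpIndicator_apply_of_notMem (A := A ∩ B)
        fun h => hB h.2, mul_zero]
  · rw [lpIndicator_apply_of_notMem hA, lpIndicator_apply_of_notMem (A := A ∩ B)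
      fun h => hA h.1, zero_mul]

/-- Inclusion–exclusion is what makes the filter of a character prime. -/
lemma lpIndicator_union (A B : Set α) :
    lpIndicator S (A ∪ B) = lpIndicator S A + lpIndicator S B - lpIndicator S (A ∩ B) := by
  ext p
  rw [lp.coeFn_sub, lp.coeFn_add, Pi.sub_apply, Pi.add_apply]
  by_cases hA : (p : α) ∈ A
  · rw [lpIndicator_apply_of_mem (Set.mem_union_left B hA), lpIndicator_apply_of_mem hA]
    by_cases hB : (p : α) ∈ B
    · rw [lpIndicator_apply_of_mem hB, lpIndicator_apply_of_mem (A := A ∩ B) ⟨hA, hB⟩]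
      ring
    · rw [lpIndicator_apply_of_notMem hB, lpIndicator_apply_of_notMem (A := A ∩ B) fun h => hB h.2]
      ring
  · rw [lpIndicator_apply_of_notMem hA, lpIndicator_apply_of_notMem (A := A ∩ B) fun h => hA h.1]
    by_cases hB : (p : α) ∈ B
    · rw [lpIndicator_apply_of_mem hB, lpIndicator_apply_of_mem (Set.mem_union_right A hB)]
      ring
    · rw [lpIndicator_apply_of_notMem hB, lpIndicator_apply_of_notMem (A := A ∪ B)
        fun h => h.elim hA hB]
      ring

lemma star_lpIndicator (A : Set α) : star (lpIndicator S A) = lpIndicator S A := by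
  ext p
  rw [lp.coeFn_star, Pi.star_apply]
  by_cases hA : (p : α) ∈ A
  · rw [lpIndicator_apply_of_mem hA, star_one]
  · rw [lpIndicator_apply_of_notMem hA, star_zero]

lemma lpIndicator_empty : lpIndicator S (∅ : Set α) = 0 := by
  ext p
  exact lpIndicator_apply_of_notMem fun h => h

end Indicator

namespace RelRing

variable {X : Type u} (R : RelRing X) (S : Set (X × X))

/-- The linear span of the indicator functions of the members of a ring of relations. -/
noncomputable def spanIndicator : NonUnitalStarSubalgebra ℂ (lp (fun _ : S => ℂ) ∞) where
  toSubmodule := Submodule.span ℂ (lpIndicator S '' R.carrier)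
  mul_mem' := by
    intro a b ha hb
    refine Submodule.span_induction₂ (p := fun a b _ _ =>
      a * b ∈ Submodule.span ℂ (lpIndicator S '' R.carrier)) ?_ ?_ ?_ ?_ ?_ ?_ ?_ ha hb
    · rintro _ _ ⟨A, hA, rfl⟩ ⟨B, hB, rfl⟩
      rw [lpIndicator_mul]
      exact Submodule.subset_span ⟨_, inter_mem hA hB, rfl⟩
    · intro y _
      rw [zero_mul]
      exact Submodule.zero_mem _
    · intro y _
      rw [mul_zero]
      exact Submodule.zero_mem _
    · intro x y z _ _ _ h₁ h₂
      rw [add_mul]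
      exact Submodule.add_mem _ h₁ h₂
    · intro x y z _ _ _ h₁ h₂
      rw [mul_add]
      exact Submodule.add_mem _ h₁ h₂
    · intro c x y _ _ h
      rw [smul_mul_assoc]
      exact Submodule.smul_mem _ _ h
    · intro c x y _ _ h
      rw [mul_smul_comm]
      exact Submodule.smul_mem _ _ h
  star_mem' := by
    intro a ha
    refine Submodule.span_induction (p := fun a _ =>
      star a ∈ Submodule.span ℂ (lpIndicator S '' R.carrier)) ?_ ?_ ?_ ?_ ha
    · rintro _ ⟨A, hA, rfl⟩
      rw [star_lpIndicator]
      exact Submodule.subset_span ⟨_, hA, rfl⟩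
    · rw [star_zero]
      exact Submodule.zero_mem _
    · intro x y _ _ h₁ h₂
      rw [star_add]
      exact Submodule.add_mem _ h₁ h₂
    · intro c x _ h
      rw [star_smul]
      exact Submodule.smul_mem _ _ h

/-- The C⋆-algebra generated by the indicator functions of the members of a ring of relations. -/
noncomputable def indicatorAlgebra : NonUnitalStarSubalgebra ℂ (lp (fun _ : S => ℂ) ∞) :=
  (R.spanIndicator S).topologicalClosure

noncomputable instance : NonUnitalCommRing (R.indicatorAlgebra S) := inferInstance

noncomputable instance : AddCommMonoid (R.indicatorAlgebra S) := inferInstance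

noncomputable instance : NonUnitalNonAssocSemiring (R.indicatorAlgebra S) := inferInstance

noncomputable instance : Module ℂ (R.indicatorAlgebra S) := inferInstance

noncomputable instance : SMul ℂ (R.indicatorAlgebra S) := Module.toDistribMulAction.toSMul

lemma separableSpace_indicatorAlgebra (hR : R.carrier.Countable) :
    TopologicalSpace.SeparableSpace (R.indicatorAlgebra S) :=
  ((hR.image _).isSeparable.span (R := ℂ)).closure.separableSpace

variable {R S}

variable (S) in
/-- The indicator function of a member of `R`, as an element of the algebra. -/
noncomputable def indicatorElem {A : SetRel X X} (hA : A ∈ R.carrier) : R.indicatorAlgebra S :=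
  ⟨lpIndicator S A, subset_closure (Submodule.subset_span ⟨A, hA, rfl⟩)⟩

lemma indicatorElem_mul {A B : SetRel X X} (hA : A ∈ R.carrier) (hB : B ∈ R.carrier) :
    indicatorElem S hA * indicatorElem S hB = indicatorElem S (inter_mem hA hB) :=
  Subtype.ext (lpIndicator_mul A B)

lemma indicatorElem_union {A B : SetRel X X} (hA : A ∈ R.carrier) (hB : B ∈ R.carrier) :
    indicatorElem S (R.union_mem hA hB) = indicatorElem S hA + indicatorElem S hB -
      indicatorElem S hA * indicatorElem S hB := by
  rw [indicatorElem_mul]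
  exact Subtype.ext (lpIndicator_union A B)

/-- Continuous linear functionals on the algebra are determined by the indicator functions. -/
lemma indicatorAlgebra_hom_ext {χ ψ : R.indicatorAlgebra S →L[ℂ] ℂ}
    (h : ∀ A (hA : A ∈ R.carrier), χ (indicatorElem S hA) = ψ (indicatorElem S hA)) : χ = ψ := by
  have key : ∀ v ∈ Submodule.span ℂ (lpIndicator S '' R.carrier),
      ∀ hv : v ∈ R.indicatorAlgebra S, χ ⟨v, hv⟩ = ψ ⟨v, hv⟩ := by
    intro v hv
    have hle : ∀ v ∈ Submodule.span ℂ (lpIndicator S '' R.carrier), v ∈ R.indicatorAlgebra S :=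
      fun v hv => subset_closure hv
    induction hv using Submodule.span_induction with
    | mem x hx =>
      obtain ⟨A, hA, rfl⟩ := hx
      exact fun _ => h A hA
    | zero => exact fun _ => χ.map_zero.trans ψ.map_zero.symm
    | add x y hx hy hx' hy' =>
      intro hv
      have h₁ : (⟨x + y, hv⟩ : R.indicatorAlgebra S) = ⟨x, hle x hx⟩ + ⟨y, hle y hy⟩ := rfl
      rw [h₁, χ.map_add, ψ.map_add, hx', hy']
    | smul c x hx hx' =>
      intro hv
      have h₁ : (⟨c • x, hv⟩ : R.indicatorAlgebra S) = c • ⟨x, hle x hx⟩ := rfl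
      rw [h₁, χ.map_smul, ψ.map_smul, hx']
  ext ⟨f, hf⟩
  obtain ⟨v, hv, hvf⟩ := mem_closure_iff_seq_limit.1 hf
  let w : ℕ → R.indicatorAlgebra S := fun n => ⟨v n, subset_closure (hv n)⟩
  have hw : Filter.Tendsto w Filter.atTop (𝓝 ⟨f, hf⟩) := tendsto_subtype_rng.2 hvf
  refine tendsto_nhds_unique ((χ.continuous.tendsto _).comp hw) ?_
  refine ((ψ.continuous.tendsto _).comp hw).congr fun n => ?_
  exact (key (v n) (hv n) _).symm

/-! ### Arrows as characters -/

namespace Arrow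

/-- An indicator is constant on A or on B \ A, and one of them lies in γ; linear combinations need
only finite intersections. -/
lemma exists_eq_const_of_mem_span (γ : R.Arrow) {f : lp (fun _ : S => ℂ) ∞}
    (hf : f ∈ Submodule.span ℂ (lpIndicator S '' R.carrier)) :
    ∃ A ∈ γ.sets, ∃ c : ℂ, ∀ p : S, (p : X × X) ∈ A → f p = c := by
  induction hf using Submodule.span_induction with
  | mem x hx =>
    obtain ⟨A, hA, rfl⟩ := hx
    obtain ⟨B, hB⟩ := γ.nonempty
    rcases γ.mem_or_sdiff_mem hA hB with h | h
    · exact ⟨A, h, 1, fun p hp => lpIndicator_apply_of_mem hp⟩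
    · exact ⟨_, h, 0, fun p hp => lpIndicator_apply_of_notMem hp.2⟩
  | zero =>
    obtain ⟨B, hB⟩ := γ.nonempty
    exact ⟨B, hB, 0, fun _ _ => rfl⟩
  | add x y _ _ hx hy =>
    obtain ⟨A, hA, c, hc⟩ := hx
    obtain ⟨B, hB, d, hd⟩ := hy
    refine ⟨A ∩ B, γ.inter hA hB, c + d, fun p hp => ?_⟩
    rw [lp.coeFn_add, Pi.add_apply, hc p hp.1, hd p hp.2]
  | smul a x _ hx =>
    obtain ⟨A, hA, c, hc⟩ := hx
    refine ⟨A, hA, a • c, fun p hp => ?_⟩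
    rw [lp.coeFn_smul, Pi.smul_apply, hc p hp]

/-- Uniform approximation from the span. Near-constancy on a member gives both the existence of
limits along γ and their continuity in γ. -/
lemma exists_norm_sub_le (γ : R.Arrow) (f : R.indicatorAlgebra S) {ε : ℝ} (hε : 0 < ε) :
    ∃ A ∈ γ.sets, ∃ c : ℂ, ∀ p : S, (p : X × X) ∈ A →
      ‖(f : lp (fun _ : S => ℂ) ∞) p - c‖ ≤ ε := by
  obtain ⟨g, hg, hfg⟩ := Metric.mem_closure_iff.1 f.2 ε hε
  obtain ⟨A, hA, c, hc⟩ := γ.exists_eq_const_of_mem_span hg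
  refine ⟨A, hA, c, fun p hp => ?_⟩
  rw [dist_eq_norm] at hfg
  have h := lp.norm_apply_le_norm ENNReal.top_ne_zero ((f : lp (fun _ : S => ℂ) ∞) - g) p
  rw [lp.coeFn_sub, Pi.sub_apply, hc p hp] at h
  exact h.trans hfg.le

variable (S) in
/-- The filter on `S` generated by the members of an arrow. -/
def toFilter (γ : R.Arrow) : Filter S where
  sets := {U | ∃ A ∈ γ.sets, ∀ p : S, (p : X × X) ∈ A → p ∈ U}
  univ_sets := γ.nonempty.imp fun _ hA => ⟨hA, fun _ _ => trivial⟩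
  sets_of_superset := fun ⟨A, hA, h⟩ hUV => ⟨A, hA, fun p hp => hUV (h p hp)⟩
  inter_sets := fun ⟨A, hA, h⟩ ⟨B, hB, h'⟩ =>
    ⟨A ∩ B, γ.inter hA hB, fun p hp => ⟨h p hp.1, h' p hp.2⟩⟩

lemma toFilter_neBot (hRS : ∀ A ∈ R.carrier, A ⊆ S) (γ : R.Arrow) : (γ.toFilter S).NeBot := by
  refine Filter.forall_mem_nonempty_iff_neBot.1 ?_
  rintro U ⟨A, hA, hAU⟩
  obtain ⟨p, hp⟩ := γ.exists_mem hA
  exact ⟨⟨p, hRS A (γ.sub hA) hp⟩, hAU _ hp⟩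

lemma exists_tendsto (hRS : ∀ A ∈ R.carrier, A ⊆ S) (γ : R.Arrow) (f : R.indicatorAlgebra S) :
    ∃ c, Filter.Tendsto (f : lp (fun _ : S => ℂ) ∞) (γ.toFilter S) (𝓝 c) := by
  have := toFilter_neBot hRS γ
  refine cauchy_map_iff_exists_tendsto.1 (Metric.cauchy_iff.2 ⟨inferInstance, fun ε hε => ?_⟩)
  -- Two points of a closed ball of radius ε/3 are at distance at most 2ε/3 < ε.
  obtain ⟨A, hA, c, hc⟩ := γ.exists_norm_sub_le f (ε := ε / 3) (by positivity)
  refine ⟨Metric.closedBall c (ε / 3), ⟨A, hA, fun p hp => ?_⟩, fun x hx y hy => ?_⟩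
  · exact mem_closedBall_iff_norm.2 (hc p hp)
  · have := dist_triangle_right x y c
    have := Metric.mem_closedBall.1 hx
    have := Metric.mem_closedBall.1 hy
    linarith

/-- The limit of a function along an arrow. -/
noncomputable def lim (hRS : ∀ A ∈ R.carrier, A ⊆ S) (γ : R.Arrow) (f : R.indicatorAlgebra S) : ℂ :=
  (exists_tendsto hRS γ f).choose

variable (hRS : ∀ A ∈ R.carrier, A ⊆ S)

lemma tendsto_lim (γ : R.Arrow) (f : R.indicatorAlgebra S) :
    Filter.Tendsto (f : lp (fun _ : S => ℂ) ∞) (γ.toFilter S) (𝓝 (lim hRS γ f)) :=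
  (exists_tendsto hRS γ f).choose_spec

lemma lim_eq {γ : R.Arrow} {f : R.indicatorAlgebra S} {c : ℂ}
    (h : Filter.Tendsto (f : lp (fun _ : S => ℂ) ∞) (γ.toFilter S) (𝓝 c)) : lim hRS γ f = c :=
  haveI := toFilter_neBot hRS γ
  tendsto_nhds_unique (tendsto_lim hRS γ f) h

lemma norm_lim_sub_le {γ : R.Arrow} {f : R.indicatorAlgebra S} {A : SetRel X X} (hA : A ∈ γ.sets)
    {c : ℂ} {ε : ℝ} (h : ∀ p : S, (p : X × X) ∈ A → ‖(f : lp (fun _ : S => ℂ) ∞) p - c‖ ≤ ε) :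
    ‖lim hRS γ f - c‖ ≤ ε :=
  haveI := toFilter_neBot hRS γ
  mem_closedBall_iff_norm.1 (Metric.isClosed_closedBall.mem_of_tendsto (tendsto_lim hRS γ f)
    ⟨A, hA, fun p hp => mem_closedBall_iff_norm.2 (h p hp)⟩)

lemma lim_indicatorElem_of_mem {γ : R.Arrow} {A : SetRel X X} (hA : A ∈ R.carrier)
    (h : A ∈ γ.sets) : lim hRS γ (indicatorElem S hA) = 1 :=
  lim_eq hRS <| tendsto_const_nhds.congr' ⟨A, h, fun _ hp => (lpIndicator_apply_of_mem hp).symm⟩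

lemma lim_indicatorElem_of_notMem {γ : R.Arrow} {A : SetRel X X} (hA : A ∈ R.carrier)
    (h : A ∉ γ.sets) : lim hRS γ (indicatorElem S hA) = 0 := by
  obtain ⟨B, hB⟩ := γ.nonempty
  exact lim_eq hRS <| tendsto_const_nhds.congr' ⟨_, (γ.mem_or_sdiff_mem hA hB).resolve_left h,
    fun _ hp => (lpIndicator_apply_of_notMem hp.2).symm⟩

lemma lim_principal (p : S) (hp : ∃ A ∈ R.carrier, (p : X × X) ∈ A) (f : R.indicatorAlgebra S) :
    lim hRS (principal p hp) f = (f : lp (fun _ : S => ℂ) ∞) p := by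
  have h : pure p ≤ (principal (R := R) p hp).toFilter S := by
    rintro U ⟨A, ⟨-, hA⟩, hAU⟩
    exact hAU p hA
  exact tendsto_nhds_unique ((tendsto_lim hRS _ f).mono_left h) (tendsto_pure_nhds _ _)

lemma dist_lim_le (γ : R.Arrow) (f g : R.indicatorAlgebra S) :
    dist (lim hRS γ f) (lim hRS γ g) ≤ dist f g := by
  have := toFilter_neBot hRS γ
  refine le_of_tendsto ((tendsto_lim hRS γ f).dist (tendsto_lim hRS γ g))
    (Filter.Eventually.of_forall fun p => ?_)
  have h := lp.norm_apply_le_norm ENNReal.top_ne_zero (f.1 - g.1) p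
  rwa [lp.coeFn_sub, Pi.sub_apply, ← dist_eq_norm, ← dist_eq_norm] at h

/-- Limits along an arrow form a continuous linear functional. -/
noncomputable def limCLM (γ : R.Arrow) : R.indicatorAlgebra S →L[ℂ] ℂ where
  toFun := lim hRS γ
  map_add' f g := lim_eq hRS ((tendsto_lim hRS γ f).add (tendsto_lim hRS γ g))
  map_smul' c f := lim_eq hRS ((tendsto_lim hRS γ f).const_smul c)
  cont := (LipschitzWith.of_dist_le_mul (K := 1) fun f g => by
    rw [NNReal.coe_one, one_mul]
    exact dist_lim_le hRS γ f g).continuous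

lemma limCLM_apply (γ : R.Arrow) (f : R.indicatorAlgebra S) : limCLM hRS γ f = lim hRS γ f := rfl

/-- The character of the algebra defined by an arrow. -/
noncomputable def toCharacter (γ : R.Arrow) :
    WeakDual.characterSpace ℂ (R.indicatorAlgebra S) :=
  ⟨limCLM hRS γ, by
    refine ⟨fun h => ?_, fun f g =>
      lim_eq hRS ((tendsto_lim hRS γ f).mul (tendsto_lim hRS γ g))⟩
    obtain ⟨A, hA⟩ := γ.nonempty
    have h₁ : lim hRS γ (indicatorElem S (γ.sub hA)) = 0 := DFunLike.congr_fun h _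
    rw [lim_indicatorElem_of_mem hRS _ hA] at h₁
    exact one_ne_zero h₁⟩

lemma toCharacter_apply (γ : R.Arrow) (f : R.indicatorAlgebra S) :
    toCharacter hRS γ f = lim hRS γ f := rfl

/-- The member A and constant c found for γ control the limit along every δ containing A. -/
lemma continuous_lim (f : R.indicatorAlgebra S) : Continuous fun γ => lim hRS γ f := by
  refine continuous_iff_continuousAt.2 fun γ => Metric.tendsto_nhds.2 fun ε hε => ?_
  obtain ⟨A, hA, c, hc⟩ := γ.exists_norm_sub_le f (ε := ε / 3) (by positivity)
  refine Filter.mem_of_superset (basic_mem_nhds hA) fun δ hδ => ?_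
  have h₁ := norm_lim_sub_le hRS hA hc
  have h₂ := norm_lim_sub_le hRS hδ hc
  rw [← dist_eq_norm] at h₁ h₂
  have h₃ := dist_triangle_right (lim hRS δ f) (lim hRS γ f) c
  exact h₃.trans_lt (by linarith)

lemma continuous_toCharacter : Continuous (toCharacter (R := R) hRS) :=
  (WeakDual.continuous_of_continuous_eval fun f => continuous_lim hRS f).subtype_mk _

/-- The arrow defined by a character of the algebra. -/
def ofCharacter (χ : WeakDual.characterSpace ℂ (R.indicatorAlgebra S)) : R.Arrow where
  sets := {A | ∃ hA : A ∈ R.carrier, χ (indicatorElem S hA) ≠ 0}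
  sub h := h.1
  nonempty := by
    by_contra! h
    -- A functional vanishing on all indicators vanishes on their closed span, whereas a character
    -- is nonzero.
    refine χ.2.1 (indicatorAlgebra_hom_ext (χ := WeakDual.CharacterSpace.toCLM χ) (ψ := 0)
      fun A hA => ?_)
    by_contra h'
    exact h A ⟨hA, h'⟩
  empty_notMem := by
    rintro ⟨hA, h⟩
    refine h ?_
    rw [show indicatorElem S hA = 0 from Subtype.ext lpIndicator_empty, map_zero]
  mono := by
    rintro A B ⟨hA, h⟩ hB hAB
    refine ⟨hB, fun h' => h ?_⟩
    have h₁ : indicatorElem S hA * indicatorElem S hB = indicatorElem S hA := by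
      rw [indicatorElem_mul]
      exact Subtype.ext (congrArg (lpIndicator S) (Set.inter_eq_left.2 hAB))
    rw [← h₁, map_mul, h', mul_zero]
  inter := by
    rintro A B ⟨hA, h⟩ ⟨hB, h'⟩
    refine ⟨inter_mem hA hB, ?_⟩
    rw [← indicatorElem_mul hA hB, map_mul]
    exact mul_ne_zero h h'
  prime := by
    rintro A B hA hB ⟨_, h⟩
    by_contra! h'
    have hA' : χ (indicatorElem S hA) = 0 := by_contra fun h => h'.1 ⟨hA, h⟩
    have hB' : χ (indicatorElem S hB) = 0 := by_contra fun h => h'.2 ⟨hB, h⟩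
    refine h ?_
    rw [indicatorElem_union hA hB, map_sub, map_add, map_mul, hA', hB', add_zero, mul_zero,
      sub_zero]

lemma continuous_ofCharacter : Continuous (ofCharacter (R := R) (S := S)) := by
  refine continuous_iff_continuousAt.2 fun χ U hU => ?_
  obtain ⟨A, ⟨hA, hχ⟩, hAU⟩ := mem_nhds_iff.1 hU
  have hc : Continuous fun χ : WeakDual.characterSpace ℂ (R.indicatorAlgebra S) =>
      χ (indicatorElem S hA) :=
    (WeakDual.eval_continuous (indicatorElem S hA)).comp continuous_subtype_val
  refine Filter.mem_map.2 (Filter.mem_of_superset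
    ((hc.isOpen_preimage _ isOpen_compl_singleton).mem_nhds hχ) fun ψ hψ => hAU ?_)
  exact Exists.intro hA hψ

lemma ofCharacter_toCharacter (γ : R.Arrow) : ofCharacter (toCharacter hRS γ) = γ := by
  refine Eq.symm (eq_of_subset fun A hA => ?_)
  refine ⟨γ.sub hA, ?_⟩
  rw [toCharacter_apply, lim_indicatorElem_of_mem hRS _ hA]
  exact one_ne_zero

lemma toCharacter_ofCharacter (χ : WeakDual.characterSpace ℂ (R.indicatorAlgebra S)) :
    toCharacter hRS (ofCharacter χ) = χ := by
  have h : limCLM hRS (ofCharacter χ) = WeakDual.CharacterSpace.toCLM χ := by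
    refine indicatorAlgebra_hom_ext fun A hA => ?_
    rw [limCLM_apply, WeakDual.CharacterSpace.coe_toCLM]
    by_cases h : χ (indicatorElem S hA) = 0
    · have hA' : A ∉ (ofCharacter χ).sets := fun h' => h'.choose_spec h
      rw [lim_indicatorElem_of_notMem hRS hA hA', h]
    · have hA' : A ∈ (ofCharacter χ).sets := ⟨hA, h⟩
      rw [lim_indicatorElem_of_mem hRS hA hA']
      -- Indicators are idempotent, so a nonzero character value on one is 1.
      have h₁ : indicatorElem S hA * indicatorElem S hA = indicatorElem S hA := by
        rw [indicatorElem_mul]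
        exact Subtype.ext (congrArg (lpIndicator S) (Set.inter_self A))
      have h₂ := map_mul χ (indicatorElem S hA) (indicatorElem S hA)
      rw [h₁] at h₂
      exact (mul_right_cancel₀ h ((one_mul _).trans h₂))
  exact WeakDual.CharacterSpace.ext fun f => DFunLike.congr_fun h f

/-- The space of arrows is the spectrum of the algebra generated by the indicator functions. -/
noncomputable def homeomorphCharacterSpace :
    R.Arrow ≃ₜ WeakDual.characterSpace ℂ (R.indicatorAlgebra S) where
  toFun := toCharacter hRS
  invFun := ofCharacter
  left_inv := ofCharacter_toCharacter hRS
  right_inv := toCharacter_ofCharacter hRS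
  continuous_toFun := continuous_toCharacter hRS
  continuous_invFun := continuous_ofCharacter

end Arrow

end RelRing

/-! ### Assembling the groupoid -/

open RelRing Arrow in
/-- The groupoid is the space of prime filters of a countable ring of relations. Uniform local
finiteness and the inclusion of the diagonal in `T` are not used: both follow from the label. -/
theorem mainTheorem5 {X : Type u} (𝒞 : CoarseStructure X) (h𝒞 : 𝒞.UniformlyLocallyFinite)
    (T : SetRel X X) (hT : 𝒞.IsGeneratedBy T) (hTdiag : SetRel.id ⊆ T)
    (k : ℕ) (φ : Fin (k + 1) → SetRel X X) (hφ : IsLabel T φ)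
    (h : 𝒞.connected → ℝ≥0∞) :
    ∃ (Γ : Type u) (_ : TopologicalSpace Γ) (𝒢 : GroupoidStr Γ)
      (Θ : 𝒞.connected → Γ) (H : Γ → ℝ≥0∞) (G : Fin (k + 1) → Set Γ),
      -- `Γ` is a locally compact Hausdorff second countable étale groupoid
      LocallyCompactSpace Γ ∧ T2Space Γ ∧ SecondCountableTopology Γ ∧ 𝒢.IsEtale ∧
      -- `Γ` is the Gelfand spectrum of a separable C⋆-subalgebra `C` of `ℓ^∞(X⁽²⁾)`,
      -- and `Θ` is evaluation at the points of `X⁽²⁾`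
      (∃ C : NonUnitalStarSubalgebra ℂ (lp (fun _ : 𝒞.connected => ℂ) ∞),
        IsClosed (C : Set (lp (fun _ : 𝒞.connected => ℂ) ∞)) ∧
        TopologicalSpace.SeparableSpace C ∧
        ∃ e : Γ ≃ₜ WeakDual.characterSpace ℂ C,
          ∀ (p : 𝒞.connected) (f : C),
            e (Θ p) f = (f : lp (fun _ : 𝒞.connected => ℂ) ∞) p) ∧
      𝒞.pairGroupoid.IsHom 𝒢 Θ ∧
      Continuous H ∧
      G 0 = 𝒢.units ∧
      (∀ j, IsCompact (G j) ∧ IsOpen (G j)) ∧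
      -- (a)
      IsCompact 𝒢.units ∧
      -- (b)
      (∀ p, H (Θ p) = h p) ∧
      -- (c)
      𝒢.IsGeneratedBy (⋃ j, G j) ∧
      -- (d)
      (∀ j, Set.InjOn 𝒢.t (G j) ∧ Set.InjOn 𝒢.s (G j)) ∧
      -- (e)
      (∀ j, closure (Θ '' ({p | (p : X × X) ∈ φ j} : Set 𝒞.connected)) = G j ∧
        Θ ⁻¹' (G j) = ({p | (p : X × X) ∈ φ j} : Set 𝒞.connected)) ∧
      -- (f)
      (∀ (γ : Γ) (x : X), 𝒢.t γ = Θ ⟨(x, x), 𝒞.connected_refl x⟩ →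
        ∃ (z : X) (hz : (x, z) ∈ 𝒞.connected), γ = Θ ⟨(x, z), hz⟩) ∧
      (∀ (γ : Γ) (y : X), 𝒢.s γ = Θ ⟨(y, y), 𝒞.connected_refl y⟩ →
        ∃ (z : X) (hz : (z, y) ∈ 𝒞.connected), γ = Θ ⟨(z, y), hz⟩) := by
  obtain ⟨Q, hQc, hQ⟩ := TopologicalSpace.exists_countable_dense ℝ≥0∞
  -- The ring must be stable under intersection with these sets for `h` to extend; restricting q to
  -- the countable dense Q keeps it countable.
  let L : ℝ≥0∞ → Set (X × X) := fun q => {p | ∃ hp : p ∈ 𝒞.connected, q < h ⟨p, hp⟩}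
  obtain ⟨R, hRc, hTR, hφR, hRL, hR𝒞, hRT⟩ := 𝒞.exists_relRing hT hφ (hQc.image L)
  have hRS : ∀ A ∈ R.carrier, A ⊆ 𝒞.connected := fun A hA => Set.subset_sUnion_of_mem (hR𝒞 hA)
  have hS : ∀ p : 𝒞.connected, ∃ A ∈ R.carrier, (p : X × X) ∈ A := by
    rintro ⟨p, F, hF, hp⟩
    obtain ⟨n, hn⟩ := (hT F).1 hF
    exact ⟨_, npow_mem hTR n, hn hp⟩
  obtain ⟨H, hH, hHh⟩ := exists_continuous_extension hS h hQ
    fun A hA q hq => hRL A hA _ ⟨q, hq, rfl⟩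
  refine ⟨R.Arrow, inferInstance, groupoid R, fun p => principal p (hS p), H,
    fun j => basic R (φ j), inferInstance, inferInstance, secondCountableTopology hRc, isEtale,
    ⟨R.indicatorAlgebra 𝒞.connected, isClosed_closure, R.separableSpace_indicatorAlgebra _ hRc,
      homeomorphCharacterSpace hRS, fun p f => lim_principal hRS p (hS p) f⟩,
    ⟨fun a => (t_principal _).symm, fun a => (s_principal _).symm, ?_⟩, hH, ?_,
    fun j => ⟨isCompact_basic (hφR j), isOpen_basic (hφR j)⟩, isCompact_basic R.id_mem, hHh,
    isGeneratedBy hTR hRT hφ hφR, fun j => ⟨?_, ?_⟩, fun j => ⟨?_, ?_⟩, ?_, ?_⟩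
  · rintro ⟨⟨x, y⟩, hxy⟩ ⟨⟨y', z⟩, hyz⟩ hab h'
    obtain rfl : y = y' := congrArg (fun p => p.1.1) hab
    exact (mul_principal _ _ _ h').symm
  · change basic R (φ 0) = units R
    rw [hφ.zero]
    rfl
  · exact fun γ hγ δ hδ => eq_of_t_eq (hφ.isBisection j).1 hγ hδ
  · exact fun γ hγ δ hδ => eq_of_s_eq (hφ.isBisection j).2 hγ hδ
  · exact closure_image_principal hS (hφR j) (hRS _ (hφR j))
  · exact Set.ext fun p => and_iff_right (hφR j)
  · intro γ x hγ
    obtain ⟨z, ⟨A, hA, hz⟩, hγz⟩ := eq_principal_of_t_eq hγ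
    exact ⟨z, hRS A hA hz, hγz⟩
  · intro γ y hγ
    obtain ⟨z, ⟨A, hA, hz⟩, hγz⟩ := eq_principal_of_s_eq hγ
    exact ⟨z, hRS A hA hz, hγz⟩
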